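/- **Setting.** For $c=(\mathrm a,\mathrm b)\in\mathbb R^2$ let $F_c:\mathbb R^2\to\mathbb R^2$ be the map $F_c(x,y)=(\mathrm a x-y,x)$ if $x>0$ or ($x=0$ and $y\le 0$) (symbol $a$), and $F_c(x,y)=(\mathrm b x-y,x)$ otherwise (symbol $b$). The symbolic word of a point is the sequence of symbols along its forward orbit. For words $u,w$ let $|w|_u$ be the number of occurrences of $u$ as a factor of $w$. We say that $F_c$ has rotation number $\theta(c)$ if for every $z\neq 0$ the prefix $W_n$ of length $n$ of the symbolic word of $z$ satisfies $\frac1n|W_n|_{ab}\to\theta(c)$. For a finite word $w=w_0\cdots w_{n-1}$ in $a,b$, the rank is $1+|w|_{ab}+|w|_{ba}$. Let $Q_0=0$, $Q_1=1$, $Q_{t+1}=w_tQ_t-Q_{t-1}$ in $\mathbb Z[a,b]$, let $k=\lfloor n/2\rfloor$, and put $C_w=Q_n$ if the rank is even; if the rank is odd, put $C_w=Q_{k+1}-Q_k$ for $n$ odd and $C_w=Q_{k+1}-Q_{k-1}$ for $n$ even. The curve of $w$ is $\{c\in\mathbb R^2: C_w(c)=0\}$; it is called critical if the rank is odd. Let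 $z_0=(0,-1)$ if $w_0=a$ and $z_0=(0,1)$ if $w_0=b$, and $z_t=F_c^t(z_0)$. The parameter $c$ is legal for $w$ if $z_n$ lies on the ordinate axis $x=0$ and, for each $0\le t<n$, either $z_t$ lies on that axis or the symbol of $z_t$ is $w_t$. The legal arc of $w$ is the set of legal points of its curve. Put $\zeta_j=2\cos(\pi/j)$, $\mathbf c_{\kappa,\ell}=(\zeta_\kappa,\zeta_\ell)$, $\vartheta^{\pm}_{j,m}=\dfrac{m}{mj\pm1}$, $\zeta^{\pm}_{j,m}=2\cos(\pi\vartheta^{\pm}_{j,m})$. **Theorem.** (i) For all integers $\kappa,\ell\ge2$ the words $a^{\kappa+1}b^\ell$ and $b^{\ell+1}a^\kappa$ have rank $2$ and define the same curve: their polynomials $C_w$ coincide, and so do their legal arcs. This legal arc lies in the first quadrant $\{\mathrm a,\mathrm b\ge0\}$ and is a simple arc with end-points $\mathbf c_{\kappa,\ell+1}$ and $\mathbf c_{\kappa+1,\ell}$. (ii) For every integer $m\ge1$, each of the following words $w^{(m)}$ has rank $2m+1$, and thus defines a critical curve. Its legal arc lies in the first quadrant and is a simple arc with end-points $\mathbf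 e$ (independent of $m$, the basis of the pencil) and $\mathbf e_m$, and the rotation numbers at these points exist and are as given: $$ \begin{array}{lccccc} & w^{(m)} & \mathbf e & \theta(\mathbf e) & \mathbf e_m & \theta(\mathbf e_m)\\ 1)& (a^{\kappa+1}b^{\ell})^m a^\kappa & \mathbf c_{\kappa,\ell+1} & \frac1{\kappa+\ell+1} & (\zeta_{\kappa+1},\zeta^-_{\ell,m}) & \vartheta^-_{\kappa+\ell+1,m}\\ 2)& a^{\kappa+1}(b^{\ell}a^{\kappa})^m & \mathbf c_{\kappa+1,\ell-1} & \frac1{\kappa+\ell} & (\zeta_{\kappa},\zeta^+_{\ell,m}) & \vartheta^+_{\kappa+\ell,m}\\ 3)& (b^{\ell+1}a^{\kappa})^m b^\ell & \mathbf c_{\kappa+1,\ell} & \frac1{\kappa+\ell+1} & (\zeta^-_{\kappa,m},\zeta_{\ell+1}) & \vartheta^-_{\kappa+\ell+1,m}\\ 4)& b^{\ell+1}(a^{\kappa}b^{\ell})^m & \mathbf c_{\kappa-1,\ell+1} & \frac1{\kappa+\ell} & (\zeta^+_{\kappa,m},\zeta_\ell) & \vartheta^+_{\kappa+\ell,m}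 \end{array} $$ where $\kappa\ge2$, $\ell>2$ in 1) and 2), and $\kappa>2$, $\ell\ge2$ in 3) and 4). -/

import Mathlib

noncomputable section

namespace CriticalCurves

open Filter Topology

/-- The two symbols, `a` for the right half-plane and `b` for the left half-plane. -/
inductive Letter
  | a
  | b
  deriving DecidableEq

/-- Finite words `w = w₀ w₁ ⋯ wₙ₋₁`. -/
abbrev Word := List Letter

/-- The value of a symbol at the parameter pair `c = (a, b)`. -/
def param (c : ℝ × ℝ) : Letter → ℝ
  | Letter.a => c.1
  | Letter.b => c.2

/-- The symbol of a phase point: `a` if `x > 0` or `x = 0 ∧ y ≤ 0`, and `b` otherwise. -/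
def symbol (z : ℝ × ℝ) : Letter :=
  if 0 < z.1 ∨ (z.1 = 0 ∧ z.2 ≤ 0) then Letter.a else Letter.b

/-- The piecewise linear map `F` with parameters `c = (a, b)`: it sends `(x, y)` to
`(a x - y, x)` or to `(b x - y, x)`, according to the symbol of `(x, y)`. -/
def F (c z : ℝ × ℝ) : ℝ × ℝ := (param c (symbol z) * z.1 - z.2, z.1)

/-- The number of occurrences of the factor `u` in the word `w`. -/
def factorCount (u w : Word) : ℕ := w.tails.countP (fun s => u.isPrefixOf s)

/-- The prefix of length `n` of the symbolic word of the forward orbit of `z`. -/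
def code (c z : ℝ × ℝ) (n : ℕ) : Word := (List.range n).map fun t => symbol ((F c)^[t] z)

/-- The map with parameters `c` has rotation number `θ`: along every orbit other than the
origin, the factor `ab` occurs with frequency `θ`. -/
def HasRotationNumber (c : ℝ × ℝ) (θ : ℝ) : Prop :=
  ∀ z : ℝ × ℝ, z ≠ 0 →
    Tendsto (fun n : ℕ => (factorCount [Letter.a, Letter.b] (code c z n) : ℝ) / n) atTop (𝓝 θ)

/-- The rank `1 + |w|_{ab} + |w|_{ba}` of a word. -/
def rank (w : Word) : ℕ :=
  1 + factorCount [Letter.a, Letter.b] w + factorCount [Letter.b, Letter.a] w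

/-- The initial point of the boundary segment of a word: `(0, -1)` for a positive word (first
letter `a`), and `(0, 1)` for a negative word (first letter `b`). -/
def start : Word → ℝ × ℝ
  | Letter.b :: _ => (0, 1)
  | _ => (0, -1)

/-- `c` is a legal parameter pair for the word `w` of length `n`: the orbit of the initial
boundary ray of `w` is on a boundary ray (the ordinate axis) at time `n`, and `w` is equivalent
to its symbolic word, that is, the two agree except possibly for letters that are allocated
to a boundary ray. -/
def Legal (w : Word) (c : ℝ × ℝ) : Prop :=
  ((F c)^[w.length] (start w)).1 = 0 ∧
    ∀ t : Fin w.length,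
      ((F c)^[(t : ℕ)] (start w)).1 = 0 ∨ symbol ((F c)^[(t : ℕ)] (start w)) = w.get t

/-- The continuant polynomials of `w`: `Q₀ = 0`, `Q₁ = 1`, `Qₜ₊₁ = wₜ Qₜ - Qₜ₋₁`
(used only for `t ≤ |w|`, where all letters exist). -/
def Q (w : Word) : ℕ → MvPolynomial Letter ℤ
  | 0 => 0
  | 1 => 1
  | t + 2 => MvPolynomial.X (w.getD (t + 1) Letter.a) * Q w (t + 1) - Q w t

/-- The polynomial `C_w` of the boundary curve of a word of length `n`. For odd rank, with
`k = ⌊n/2⌋`, it is `Q_{k+1} - Q_k` if `n` is odd and `Q_{k+1} - Q_{k-1}` if `n` is even;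
for even rank it is `Q_n`. -/
def curvePoly (w : Word) : MvPolynomial Letter ℤ :=
  if Odd (rank w) then
    if Odd w.length then Q w (w.length / 2 + 1) - Q w (w.length / 2)
    else Q w (w.length / 2 + 1) - Q w (w.length / 2 - 1)
  else Q w w.length

/-- The real algebraic curve `C_w = 0` in parameter space. -/
def curve (w : Word) : Set (ℝ × ℝ) := {c | MvPolynomial.aeval (param c) (curvePoly w) = 0}

/-- The legal part of the curve: all its legal points. -/
def legalArc (w : Word) : Set (ℝ × ℝ) := {c | c ∈ curve w ∧ Legal w c}

/-- `S` is a simple (Jordan) arc with end-points `p` and `q`. -/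
def IsArcWithEndpoints (S : Set (ℝ × ℝ)) (p q : ℝ × ℝ) : Prop :=
  ∃ γ : ℝ → ℝ × ℝ, ContinuousOn γ (Set.Icc 0 1) ∧ Set.InjOn γ (Set.Icc 0 1) ∧
    γ '' Set.Icc 0 1 = S ∧ γ 0 = p ∧ γ 1 = q

/-- The first quadrant of parameter space. -/
def firstQuadrant : Set (ℝ × ℝ) := {c | 0 ≤ c.1 ∧ 0 ≤ c.2}

/-- The word `a^k`. -/
def wa (k : ℕ) : Word := List.replicate k Letter.a

/-- The word `b^l`. -/
def wb (l : ℕ) : Word := List.replicate l Letter.b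

/-- The concatenation `w^m` of `m` copies of `w`. -/
def wpow (w : Word) (m : ℕ) : Word := (List.replicate m w).flatten

/-- `ζ_j = 2 cos (π / j)`. -/
def zeta (j : ℕ) : ℝ := 2 * Real.cos (Real.pi / j)

/-- The double point `c_{k,l} = (ζ_k, ζ_l)`. -/
def doublePoint (k l : ℕ) : ℝ × ℝ := (zeta k, zeta l)

/-- `ϑ⁺_{j,m} = m / (m j + 1)`. -/
def thetaPlus (j m : ℕ) : ℝ := (m : ℝ) / ((m : ℝ) * j + 1)

/-- `ϑ⁻_{j,m} = m / (m j - 1)`. -/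
def thetaMinus (j m : ℕ) : ℝ := (m : ℝ) / ((m : ℝ) * j - 1)

/-- `ζ⁺_{j,m} = 2 cos (π ϑ⁺_{j,m})`. -/
def zetaPlus (j m : ℕ) : ℝ := 2 * Real.cos (Real.pi * thetaPlus j m)

/-- `ζ⁻_{j,m} = 2 cos (π ϑ⁻_{j,m})`. -/
def zetaMinus (j m : ℕ) : ℝ := 2 * Real.cos (Real.pi * thetaMinus j m)

/-- The word `w` defines a critical curve (odd rank, here `2m + 1`) whose legal arc lies in the
first quadrant and has end-points `e` and `e'`, where the rotation numbers are `θ` and `θ'`. -/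
def IsCriticalCurveWithEndpoints (w : Word) (m : ℕ) (e e' : ℝ × ℝ) (θ θ' : ℝ) : Prop :=
  rank w = 2 * m + 1 ∧
    legalArc w ⊆ firstQuadrant ∧
    IsArcWithEndpoints (legalArc w) e e' ∧
    HasRotationNumber e θ ∧ HasRotationNumber e' θ'

end CriticalCurves

end

open CriticalCurves

noncomputable section

namespace CriticalCurves

open Filter Topology

/-! Write Q_t for the continuants of the letters and S_n(x) for `cheb x n`. While the signs agree
with the letters, the orbit of (0,-1) is (Q_t, Q_{t-1}). Legality of a word starting with a
therefore means Q_n = 0 together with sgn(w_t) Q_t ≥ 0 for t < n (`legal_iff`). These are closed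
conditions, and the first letter does not enter them. Words starting with b reduce to this case by
the symmetry z ↦ -z, which interchanges the letters and the two parameters.

The words of odd rank are treated as periodic sequences of letters that are palindromic up to time
n. Reading the recurrence backwards from Q_n = 0 gives Q_{n-t} = Q_{n-1} Q_t, so Q_{n-1}² = 1. The
sign condition forces Q_{n-1} = 1, and the resulting symmetry of Q makes C_w vanish. The legal arc
is thus the whole set of legal points (`PencilWord.legalArc_eq`).

This set is an arc for three reasons. By Sturm comparison no two distinct legal points are ordered
in both coordinates (`sturm`, `TwoBlocks.antichain`). The signs over the first letters confine the
first parameter to [ζ_κ, ζ_{κ+1}]. Every value in that interval occurs. Projection to the first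
coordinate is then a homeomorphism onto the interval (`isArc_of_antichain`).

For existence in odd rank, the values Q_{j+ip} at times one period apart satisfy a recurrence in i
with constant coefficient τ, the trace over one period. Along a vertical segment of parameters,
Q_{q+mp} is a combination of S_m(τ) and S_{m-1}(τ). Its zeros for successive m are found before S_1,
…, S_m lose positivity (`exists_cheb_zero`). As long as these are positive, interpolation between
the first period and its mirror image propagates the signs to all times
(`PalindromicLetters.signs`). The end-points are computed from sines; at the basis the first period
already closes up, for every m. In rank two the intermediate value theorem suffices.

At each end-point one half-plane is crossed in exactly k steps as a half-turn, and the other is a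
rotation by an angle β. The polar angle, turned into a bounded potential, shows that a revolution
takes k + π/β steps on average (`hasRotationNumber_zeta`). -/

/-! ### Continuants, Chebyshev values and reversal -/

/-- The solution of `X (t + 2) = P (t + 1) * X (t + 1) - X t` with `X 0 = 0` and `X 1 = 1`. -/
def cont (P : ℕ → ℝ) : ℕ → ℝ
  | 0 => 0
  | 1 => 1
  | t + 2 => P (t + 1) * cont P (t + 1) - cont P t

/-- The rescaled Chebyshev value `sin (n θ) / sin θ` at `x = 2 cos θ`. -/
def cheb (x : ℝ) (n : ℕ) : ℝ := cont (fun _ => x) n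

/-- `Z` satisfies the three-term recurrence with coefficients `P`. -/
def IsSol (P Z : ℕ → ℝ) : Prop := ∀ t, Z (t + 2) = P (t + 1) * Z (t + 1) - Z t

@[simp] lemma cont_zero (P : ℕ → ℝ) : cont P 0 = 0 := rfl
@[simp] lemma cont_one (P : ℕ → ℝ) : cont P 1 = 1 := rfl
lemma cont_add_two (P : ℕ → ℝ) (t : ℕ) :
    cont P (t + 2) = P (t + 1) * cont P (t + 1) - cont P t := rfl
lemma isSol_cont (P : ℕ → ℝ) : IsSol P (cont P) := fun _ => rfl
@[simp] lemma cheb_zero (x : ℝ) : cheb x 0 = 0 := rfl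
@[simp] lemma cheb_one (x : ℝ) : cheb x 1 = 1 := rfl
lemma cheb_add_two (x : ℝ) (t : ℕ) : cheb x (t + 2) = x * cheb x (t + 1) - cheb x t := rfl
@[simp] lemma cheb_two (x : ℝ) : cheb x 2 = x := by simp [cheb_add_two]

/-- The coefficient at time 0 is never read, since Q_0 = 0. This is what later allows the first
letter of a word to be replaced. -/
lemma cont_congr {P P' : ℕ → ℝ} {n : ℕ} (h : ∀ s, 1 ≤ s → s < n → P s = P' s) :
    ∀ t ≤ n, cont P t = cont P' t := by
  intro t
  induction t using Nat.strong_induction_on with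
  | _ t ih =>
    intro ht
    match t, ih, ht with
    | 0, _, _ => rfl
    | 1, _, _ => rfl
    | t + 2, ih, ht =>
      rw [cont_add_two, cont_add_two, ih (t + 1) (by omega) (by omega),
        ih t (by omega) (by omega), h (t + 1) (by omega) (by omega)]

/-- Every solution is a combination of two continuants. -/
lemma IsSol.eq_cont {P Z : ℕ → ℝ} (h : IsSol P Z) (t : ℕ) :
    Z (t + 1) = Z 1 * cont P (t + 1) - Z 0 * cont (fun s => P (s + 1)) t := by
  induction t using Nat.twoStepInduction with
  | zero => simp
  | one => rw [h 0, cont_add_two]; simp; ring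
  | more t h1 h2 => rw [h (t + 1), h2, h1, cont_add_two P (t + 1), cont_add_two (fun s => P (s + 1)) t]; ring

/-- Along a block of constant coefficients a solution is a combination of Chebyshev values. -/
lemma IsSol.block {P Z : ℕ → ℝ} (h : IsSol P Z) {x : ℝ} (s : ℕ) {j : ℕ}
    (hx : ∀ i, 1 ≤ i → i ≤ j → P (s + i) = x) :
    Z (s + j + 1) = Z (s + 1) * cheb x (j + 1) - Z s * cheb x j := by
  induction j using Nat.twoStepInduction with
  | zero => simp
  | one => rw [show s + 1 + 1 = s + 2 by ring, h s, hx 1 le_rfl le_rfl]; simp; ring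
  | more j h1 h2 =>
    rw [show s + (j + 2) + 1 = (s + j + 1) + 2 by ring, h (s + j + 1),
      show s + j + 1 + 1 = s + (j + 1) + 1 by ring,
      h2 (fun i hi hj => hx i hi (by omega)), h1 (fun i hi hj => hx i hi (by omega)),
      show s + (j + 1) + 1 = s + (j + 2) by ring, hx (j + 2) (by omega) le_rfl,
      cheb_add_two x (j + 1), cheb_add_two x j]
    ring

lemma cont_eq_cheb {P : ℕ → ℝ} {x : ℝ} {n : ℕ} (h : ∀ s, 1 ≤ s → s < n → P s = x) {t : ℕ}
    (ht : t ≤ n) : cont P t = cheb x t :=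
  cont_congr h t ht

/-- The interpolation formula for the recurrence with constant coefficient. -/
lemma interpolation {τ : ℝ} {u : ℕ → ℝ} (h : IsSol (fun _ => τ) u) (i k : ℕ) :
    u i * cheb τ (i + k) = u 0 * cheb τ k + u (i + k) * cheb τ i := by
  induction k using Nat.twoStepInduction with
  | zero => simp
  | one =>
    induction i with
    | zero => simp
    | succ i ih =>
      rw [show i + 1 + 1 = i + 2 by ring, h i, cheb_add_two]
      linear_combination ih
  | more k h1 h2 =>
    rw [show i + (k + 2) = (i + k) + 2 by ring, h (i + k), cheb_add_two, cheb_add_two,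
      show i + k + 1 = i + (k + 1) by ring]
    linear_combination τ * h2 - h1

/-- The determinant identity of Chebyshev values. -/
lemma cheb_cassini (x : ℝ) (n : ℕ) : cheb x (n + 1) ^ 2 - cheb x n * cheb x (n + 2) = 1 := by
  have := interpolation (τ := x) (u := fun t => cheb x (t + 1)) (fun t => cheb_add_two x (t + 1)) n 1
  simp at this
  rw [show n + 1 + 1 = n + 2 by ring] at this
  linear_combination this

/-- Constant-coefficient solutions are nonnegative between nonnegative values. -/
lemma interpolation_nonneg {τ : ℝ} {u : ℕ → ℝ} (h : IsSol (fun _ => τ) u) {m : ℕ}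
    (hτ : ∀ j, 1 ≤ j → j ≤ m → 0 < cheb τ j) (h0 : 0 ≤ u 0) (hm : 0 ≤ u m) {i : ℕ}
    (hi : i ≤ m) : 0 ≤ u i := by
  rcases Nat.eq_zero_or_pos m with rfl | hm0
  · rwa [Nat.le_zero.mp hi]
  obtain ⟨k, rfl⟩ := Nat.exists_eq_add_of_le hi
  have key := interpolation h i k
  have nn : ∀ j ≤ i + k, 0 ≤ cheb τ j := by
    intro j hj
    rcases Nat.eq_zero_or_pos j with rfl | h0
    · simp
    · exact (hτ j h0 hj).le
  have hpos := hτ (i + k) hm0 le_rfl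
  have : 0 ≤ u i * cheb τ (i + k) := by
    rw [key]
    exact add_nonneg (mul_nonneg h0 (nn k (by omega))) (mul_nonneg hm (nn i (by omega)))
  exact nonneg_of_mul_nonneg_left this hpos

/-- Reversal of a palindromic recurrence whose continuant vanishes. -/
lemma cont_reverse {P : ℕ → ℝ} {n : ℕ} (hn : 1 ≤ n)
    (hP : ∀ t, 1 ≤ t → t < n → P (n - t) = P t) (h0 : cont P n = 0) {t : ℕ} (ht : t ≤ n) :
    cont P (n - t) = cont P (n - 1) * cont P t := by
  induction t using Nat.twoStepInduction with
  | zero => simp [h0]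
  | one => simp
  | more t h1 h2 =>
    obtain ⟨s, rfl⟩ := Nat.exists_eq_add_of_le ht
    have e1 := h1 (by omega)
    have e2 := h2 (by omega)
    have e3 := hP (t + 1) (by omega) (by omega)
    rw [show t + 2 + s - t = s + 2 by omega] at e1
    rw [show t + 2 + s - (t + 1) = s + 1 by omega] at e2 e3
    rw [show t + 2 + s - (t + 2) = s by omega, cont_add_two P t]
    have e4 := cont_add_two P s
    rw [e3] at e4
    linear_combination e4 - e1 + P (t + 1) * e2

/-- Reversal at t = n - 1 gives Q_{n-1}² = 1, and the sign hypothesis selects the root 1. -/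
lemma cont_reverse_eq {P : ℕ → ℝ} {n : ℕ} (hn : 1 ≤ n)
    (hP : ∀ t, 1 ≤ t → t < n → P (n - t) = P t) (h0 : cont P n = 0)
    (h1 : 0 ≤ cont P (n - 1)) {t : ℕ} (ht : t ≤ n) : cont P (n - t) = cont P t := by
  have h2 := cont_reverse hn hP h0 (t := n - 1) (by omega)
  rw [show n - (n - 1) = 1 by omega, cont_one] at h2
  have h3 : cont P (n - 1) = 1 := by nlinarith
  rw [cont_reverse hn hP h0 ht, h3, one_mul]

/-! ### Legality in terms of continuants -/

/-- The sign of the half-plane of a symbol. -/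
def sgn : Letter → ℝ
  | Letter.a => 1
  | Letter.b => -1

@[simp] lemma sgn_a : sgn Letter.a = 1 := rfl
@[simp] lemma sgn_b : sgn Letter.b = -1 := rfl

lemma sgn_symbol_nonneg (z : ℝ × ℝ) : 0 ≤ sgn (symbol z) * z.1 := by
  unfold symbol
  split_ifs with h
  · rcases h with h | h
    · simpa using h.le
    · simp [h.1]
  · push Not at h
    simpa using h.1

lemma symbol_eq_of_sgn {l : Letter} {z : ℝ × ℝ} (h0 : z.1 ≠ 0) (h : 0 ≤ sgn l * z.1) :
    symbol z = l := by
  unfold symbol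
  cases l with
  | a =>
    have : 0 < z.1 := lt_of_le_of_ne (by simpa using h) (Ne.symm h0)
    simp [this]
  | b =>
    have : z.1 < 0 := lt_of_le_of_ne (by simpa using h) h0
    simp [this.not_gt, this.ne]

/-- As long as the signs agree with the letters, the orbit of `(0, -1)` is given by
continuants. -/
lemma iterate_F_eq (c : ℝ × ℝ) (L : ℕ → Letter) (t : ℕ)
    (h : ∀ s ≤ t, 0 ≤ sgn (L s) * cont (fun s => param c (L s)) s) :
    (F c)^[t + 1] (0, -1) =
      (cont (fun s => param c (L s)) (t + 1), cont (fun s => param c (L s)) t) := by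
  induction t with
  | zero => simp [F]
  | succ t ih =>
    rw [Function.iterate_succ_apply', ih (fun s hs => h s (by omega)), F, cont_add_two]
    -- On the axis the parameter is multiplied by zero, so the symbol of the point is immaterial
    -- there.
    rcases eq_or_ne (cont (fun s => param c (L s)) (t + 1)) 0 with h0 | h0
    · simp [h0]
    · rw [symbol_eq_of_sgn (z := (cont (fun s => param c (L s)) (t + 1), _)) h0 (h (t + 1) le_rfl)]

lemma iterate_F_fst (c : ℝ × ℝ) (L : ℕ → Letter) (t : ℕ)
    (h : ∀ s < t, 0 ≤ sgn (L s) * cont (fun s => param c (L s)) s) :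
    ((F c)^[t] (0, -1)).1 = cont (fun s => param c (L s)) t := by
  cases t with
  | zero => simp
  | succ t => rw [iterate_F_eq c L t (fun s hs => h s (by omega))]

/-- Legality of a positive word in terms of continuants. -/
lemma legal_iff {w : Word} {L : ℕ → Letter} (hs : start w = (0, -1))
    (hL : ∀ t (ht : t < w.length), 1 ≤ t → w[t] = L t) (c : ℝ × ℝ) :
    Legal w c ↔ cont (fun s => param c (L s)) w.length = 0 ∧
      ∀ t < w.length, 0 ≤ sgn (L t) * cont (fun s => param c (L s)) t := by
  unfold Legal
  rw [hs]
  constructor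
  · rintro ⟨h0, h⟩
    have key : ∀ t < w.length, 0 ≤ sgn (L t) * cont (fun s => param c (L s)) t := by
      intro t
      induction t using Nat.strong_induction_on with
      | _ t ih =>
        intro ht
        have e := iterate_F_fst c L t (fun s hs => ih s hs (by omega))
        rcases Nat.eq_zero_or_pos t with rfl | hpos
        · simp
        rcases h ⟨t, ht⟩ with h' | h'
        · rw [← e]; simp at h'; simp [h']
        · have := sgn_symbol_nonneg ((F c)^[t] (0, -1))
          simp only [List.get_eq_getElem] at h'
          rwa [h', hL t ht hpos, e] at this
    exact ⟨by rw [← iterate_F_fst c L _ key, h0], key⟩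
  · rintro ⟨h0, h⟩
    refine ⟨by rw [iterate_F_fst c L _ h, h0], fun t => ?_⟩
    have e := iterate_F_fst c L t (fun s hs => h s (by omega))
    rcases eq_or_ne ((F c)^[(t : ℕ)] (0, -1)).1 0 with h' | h'
    · exact Or.inl h'
    · right
      rcases Nat.eq_zero_or_pos (t : ℕ) with h1 | h1
      · rw [h1] at h'; simp at h'
      rw [List.get_eq_getElem, hL t t.2 h1]
      apply symbol_eq_of_sgn h'
      rw [e]
      exact h t t.2

/-- Evaluation of the continuant polynomials. -/
lemma aeval_Q {w : Word} {L : ℕ → Letter}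
    (hL : ∀ t (ht : t < w.length), 1 ≤ t → w[t] = L t) (c : ℝ × ℝ) {t : ℕ} (ht : t ≤ w.length) :
    MvPolynomial.aeval (param c) (Q w t) = cont (fun s => param c (L s)) t := by
  induction t using Nat.twoStepInduction with
  | zero => simp [Q]
  | one => simp [Q]
  | more t h1 h2 =>
    rw [Q, cont_add_two, map_sub, map_mul, h1 (by omega), h2 (by omega), MvPolynomial.aeval_X,
      List.getD_eq_getElem _ _ (show t + 1 < w.length by omega), hL (t + 1) (by omega) (by omega)]

/-- Legal points of a palindromic word of odd rank lie on its critical curve. -/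
lemma mem_curve_of_reverse {w : Word} {L : ℕ → Letter} (hr : Odd (rank w))
    (hL : ∀ t (ht : t < w.length), 1 ≤ t → w[t] = L t) {c : ℝ × ℝ} (hn : 1 ≤ w.length)
    (h : ∀ t ≤ w.length, cont (fun s => param c (L s)) (w.length - t) =
      cont (fun s => param c (L s)) t) : c ∈ curve w := by
  simp only [curve, curvePoly, if_pos hr, Set.mem_ofPred_eq]
  -- The curve polynomial compares two continuants whose indices add up to n: k + 1 and k for n = 2k
  -- + 1, k + 1 and k - 1 for n = 2k.
  by_cases ho : Odd w.length
  · obtain ⟨k, hk⟩ := ho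
    have hk' : w.length / 2 = k := by omega
    rw [if_pos (by rw [hk]; exact ⟨k, rfl⟩), hk', map_sub, aeval_Q hL c (by omega),
      aeval_Q hL c (by omega), sub_eq_zero, ← h k (by omega)]
    congr 1; omega
  · obtain ⟨k, hk⟩ := Nat.not_odd_iff_even.mp ho
    have hk' : w.length / 2 = k := by omega
    rw [if_neg ho, hk', map_sub, aeval_Q hL c (by omega),
      aeval_Q hL c (by omega), sub_eq_zero, ← h (k - 1) (by omega)]
    congr 1; omega

/-! ### Sturm comparison and continuity -/

/-- The Sturm comparison: two sequences with the same signs, ordered coefficients and the same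
end-points are governed by the same coefficients wherever they do not vanish. -/
lemma sturm {p q s : ℕ → ℝ} {n : ℕ} (hpq : ∀ t, p t ≤ q t)
    (hs : ∀ t, s t ^ 2 = 1)
    (hX : ∀ t < n, 0 ≤ s t * cont p t) (hY : ∀ t < n, 0 ≤ s t * cont q t)
    (hX0 : cont p n = 0) (hY0 : cont q n = 0) {t : ℕ} (ht1 : 1 ≤ t) (htn : t < n) :
    cont p t * cont q t * (q t - p t) = 0 := by
  -- The Casoratian is nondecreasing, because the two solutions have the same sign and p ≤ q. It
  -- vanishes at 0 and at n - 1, so all its increments in between are zero.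
  set W : ℕ → ℝ := fun t => cont p t * cont q (t + 1) - cont p (t + 1) * cont q t with hW
  have step : ∀ t, W (t + 1) - W t = cont p (t + 1) * cont q (t + 1) * (q (t + 1) - p (t + 1)) := by
    intro t
    simp only [hW, cont_add_two]
    ring
  have nn : ∀ t, t + 1 < n → 0 ≤ W (t + 1) - W t := by
    intro t ht
    rw [step]
    refine mul_nonneg ?_ (sub_nonneg.mpr (hpq _))
    have := mul_nonneg (hX _ ht) (hY _ ht)
    nlinarith [hs (t + 1)]
  have W0 : W 0 = 0 := by simp [hW]
  have mono : ∀ i j, i ≤ j → j < n → W i ≤ W j := by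
    intro i j hij
    induction j, hij using Nat.le_induction with
    | base => intro _; exact le_rfl
    | succ j _ ih => intro hj; linarith [ih (by omega), nn j hj]
  have Wn : W (n - 1) = 0 := by
    simp only [hW]
    rw [show n - 1 + 1 = n by omega, hX0, hY0]; ring
  obtain ⟨r, rfl⟩ := Nat.exists_eq_add_of_le' ht1
  have h1 := mono 0 r (by omega) (by omega)
  have h2 := mono (r + 1) (n - 1) (by omega) (by omega)
  have h3 := nn r htn
  rw [← step]
  linarith

lemma continuous_cont {Y : Type*} [TopologicalSpace Y] {P : Y → ℕ → ℝ}
    (hP : ∀ t, Continuous fun y => P y t) (t : ℕ) : Continuous fun y => cont (P y) t := by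
  induction t using Nat.twoStepInduction with
  | zero => exact continuous_const
  | one => exact continuous_const
  | more t h1 h2 => exact ((hP (t + 1)).mul h2).sub h1

lemma continuous_cheb (n : ℕ) : Continuous fun x => cheb x n :=
  continuous_cont (fun _ => continuous_id) n

lemma continuous_param (l : Letter) : Continuous fun c => param c l := by
  cases l
  · exact continuous_fst
  · exact continuous_snd

/-- The symbol is discontinuous across the axis, but the continuants turn legality into equations
and weak inequalities between continuous functions. -/
lemma isClosed_legal {w : Word} {L : ℕ → Letter} (hs : start w = (0, -1))
    (hL : ∀ t (ht : t < w.length), 1 ≤ t → w[t] = L t) : IsClosed {c | Legal w c} := by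
  have hc : ∀ t, Continuous fun c : ℝ × ℝ => cont (fun s => param c (L s)) t :=
    fun t => continuous_cont (P := fun c s => param c (L s)) (fun t => continuous_param (L t)) t
  have : {c | Legal w c} = {c | cont (fun s => param c (L s)) w.length = 0} ∩
      ⋂ t, ⋂ (_ : t < w.length), {c | 0 ≤ sgn (L t) * cont (fun s => param c (L s)) t} := by
    ext c
    simp [legal_iff hs hL c]
  rw [this]
  refine (isClosed_eq (hc _) continuous_const).inter ?_
  exact isClosed_iInter fun t => isClosed_iInter fun _ =>
    isClosed_le continuous_const (continuous_const.mul (hc t))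

/-! ### Signs of Chebyshev values relative to the numbers ζ_j -/

lemma cheb_mul_sin (θ : ℝ) (n : ℕ) :
    cheb (2 * Real.cos θ) n * Real.sin θ = Real.sin (n * θ) := by
  induction n using Nat.twoStepInduction with
  | zero => simp
  | one => simp
  | more n h1 h2 =>
    rw [cheb_add_two, sub_mul, mul_assoc, h1, h2]
    have e1 : ((n + 2 : ℕ) : ℝ) * θ = ((n + 1 : ℕ) : ℝ) * θ + θ := by push_cast; ring
    have e2 : (n : ℝ) * θ = ((n + 1 : ℕ) : ℝ) * θ - θ := by push_cast; ring
    rw [e1, e2, Real.sin_add, Real.sin_sub]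
    ring

lemma cheb_eq_div {θ : ℝ} (h : Real.sin θ ≠ 0) (n : ℕ) :
    cheb (2 * Real.cos θ) n = Real.sin (n * θ) / Real.sin θ := by
  rw [eq_div_iff h, cheb_mul_sin]

lemma exists_angle {x : ℝ} (h1 : -2 < x) (h2 : x < 2) :
    ∃ θ, 0 < θ ∧ θ < Real.pi ∧ x = 2 * Real.cos θ := by
  refine ⟨Real.arccos (x / 2), Real.arccos_pos.mpr (by linarith), ?_, ?_⟩
  · rw [Real.arccos_lt_pi]; linarith
  · rw [Real.cos_arccos (by linarith) (by linarith)]; ring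

lemma pi_div_mem {j : ℕ} (hj : 1 ≤ j) : 0 < Real.pi / j ∧ Real.pi / j ≤ Real.pi := by
  have : (1 : ℝ) ≤ j := by exact_mod_cast hj
  exact ⟨div_pos Real.pi_pos (by linarith), div_le_self Real.pi_pos.le this⟩

lemma zeta_lt_iff {j : ℕ} (hj : 1 ≤ j) {θ : ℝ} (h0 : 0 ≤ θ) (h1 : θ ≤ Real.pi) :
    zeta j < 2 * Real.cos θ ↔ j * θ < Real.pi := by
  have hj' : (0 : ℝ) < j := by exact_mod_cast hj
  unfold zeta
  rw [mul_lt_mul_iff_right₀ two_pos, Real.strictAntiOn_cos.lt_iff_gt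
    ⟨(pi_div_mem hj).1.le, (pi_div_mem hj).2⟩ ⟨h0, h1⟩, lt_div_iff₀ hj', mul_comm]

lemma lt_zeta_iff {j : ℕ} (hj : 1 ≤ j) {θ : ℝ} (h0 : 0 ≤ θ) (h1 : θ ≤ Real.pi) :
    2 * Real.cos θ < zeta j ↔ Real.pi < j * θ := by
  have hj' : (0 : ℝ) < j := by exact_mod_cast hj
  unfold zeta
  rw [mul_lt_mul_iff_right₀ two_pos, Real.strictAntiOn_cos.lt_iff_gt ⟨h0, h1⟩
    ⟨(pi_div_mem hj).1.le, (pi_div_mem hj).2⟩, div_lt_iff₀ hj', mul_comm]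

lemma zeta_lt_two {j : ℕ} (hj : 1 ≤ j) : zeta j < 2 := by
  have := (zeta_lt_iff hj le_rfl Real.pi_pos.le).mpr (by simpa using Real.pi_pos)
  simpa using this

lemma neg_two_lt_zeta {j : ℕ} (hj : 2 ≤ j) : -2 < zeta j := by
  have h2 : (2 : ℝ) ≤ j := by exact_mod_cast hj
  have := (lt_zeta_iff (j := j) (by omega) Real.pi_pos.le le_rfl).mpr
    (by nlinarith [Real.pi_pos])
  simpa using this

lemma zeta_lt_zeta {i j : ℕ} (hi : 1 ≤ i) (hij : i < j) : zeta i < zeta j := by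
  obtain ⟨h0, h1⟩ := pi_div_mem (j := j) (by omega)
  have hj : (0 : ℝ) < j := by exact_mod_cast (by omega : 0 < j)
  have hi' : (i : ℝ) < j := by exact_mod_cast hij
  refine (zeta_lt_iff hi h0.le h1).mpr ?_
  rw [mul_div_assoc', div_lt_iff₀ hj]
  nlinarith [Real.pi_pos]

lemma zeta_le_zeta {i j : ℕ} (hi : 1 ≤ i) (hij : i ≤ j) : zeta i ≤ zeta j := by
  rcases hij.eq_or_lt with rfl | h
  · exact le_rfl
  · exact (zeta_lt_zeta hi h).le

@[simp] lemma zeta_two : zeta 2 = 0 := by simp [zeta]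

lemma zeta_nonneg {j : ℕ} (hj : 2 ≤ j) : 0 ≤ zeta j := by
  rw [← zeta_two]; exact zeta_le_zeta (by omega) hj

lemma sin_pi_div_pos {j : ℕ} (hj : 2 ≤ j) : 0 < Real.sin (Real.pi / j) := by
  have h2 : (2 : ℝ) ≤ j := by exact_mod_cast hj
  exact Real.sin_pos_of_pos_of_lt_pi (pi_div_mem (by omega)).1
    (by rw [div_lt_iff₀ (by linarith)]; nlinarith [Real.pi_pos])

/-- The half-turn of the rotation with parameter `ζ_j`. -/
lemma cheb_zeta_add {j : ℕ} (hj : 2 ≤ j) (i : ℕ) :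
    cheb (zeta j) (j + i) = -cheb (zeta j) i := by
  have h := (sin_pi_div_pos hj).ne'
  have hj' : (j : ℝ) ≠ 0 := by exact_mod_cast (by omega : j ≠ 0)
  unfold zeta
  rw [cheb_eq_div h, cheb_eq_div h, ← neg_div, ← Real.sin_add_pi]
  congr 2
  push_cast
  field_simp
  ring

lemma cheb_zeta_self {j : ℕ} (hj : 2 ≤ j) : cheb (zeta j) j = 0 := by
  simpa using cheb_zeta_add hj 0

lemma cheb_zeta_succ {j : ℕ} (hj : 2 ≤ j) : cheb (zeta j) (j + 1) = -1 := by
  simpa using cheb_zeta_add hj 1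

lemma cheb_zeta_reflect {j : ℕ} (hj : 2 ≤ j) {i : ℕ} (hi : i ≤ j) :
    cheb (zeta j) (j - i) = cheb (zeta j) i := by
  have h := (sin_pi_div_pos hj).ne'
  have hj' : (j : ℝ) ≠ 0 := by exact_mod_cast (by omega : j ≠ 0)
  unfold zeta
  rw [cheb_eq_div h, cheb_eq_div h, ← Real.sin_pi_sub]
  congr 2
  push_cast [Nat.cast_sub hi]
  field_simp
  ring

lemma cheb_zeta_pred {j : ℕ} (hj : 2 ≤ j) : cheb (zeta j) (j - 1) = 1 := by
  simpa using cheb_zeta_reflect hj (i := 1) (by omega)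

/-- For x ≥ 2 the increments of S_n(x) do not decrease, so they stay at least 1. -/
lemma cheb_pos_of_two_le {x : ℝ} (h : 2 ≤ x) {j : ℕ} (hj : 1 ≤ j) : 0 < cheb x j := by
  have key : ∀ n, 0 ≤ cheb x n ∧ 1 ≤ cheb x (n + 1) - cheb x n := by
    intro n
    induction n with
    | zero => simp
    | succ n ih => rw [cheb_add_two]; constructor <;> nlinarith
  obtain ⟨n, rfl⟩ := Nat.exists_eq_add_of_le' hj
  have := key n
  linarith

lemma cheb_pos {x : ℝ} {j : ℕ} (hj : 1 ≤ j) (h : zeta j < x) : 0 < cheb x j := by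
  rcases le_or_gt 2 x with h2 | h2
  · exact cheb_pos_of_two_le h2 hj
  have h3 : -2 < x := by
    rcases hj.eq_or_lt with rfl | hj
    · simpa [zeta] using h
    · exact (neg_two_lt_zeta hj).trans h
  obtain ⟨θ, h0, hpi, rfl⟩ := exists_angle h3 h2
  have h4 := (zeta_lt_iff hj h0.le hpi.le).mp h
  have hj' : (0 : ℝ) < j := by exact_mod_cast hj
  rw [cheb_eq_div (Real.sin_pos_of_pos_of_lt_pi h0 hpi).ne']
  exact div_pos (Real.sin_pos_of_pos_of_lt_pi (by positivity) h4)
    (Real.sin_pos_of_pos_of_lt_pi h0 hpi)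

lemma cheb_nonneg {x : ℝ} {j : ℕ} (hj : 2 ≤ j) (h : zeta j ≤ x) {i : ℕ} (hi : i ≤ j) :
    0 ≤ cheb x i := by
  rcases Nat.eq_zero_or_pos i with rfl | hi0
  · simp
  rcases hi.eq_or_lt with rfl | hlt
  · rcases h.eq_or_lt with rfl | h
    · rw [cheb_zeta_self hj]
    · exact (cheb_pos hi0 h).le
  · exact (cheb_pos hi0 ((zeta_lt_zeta hi0 hlt).trans_le h)).le

/-- With x = 2 cos θ, the bounds say kθ < π < jθ. Since j ≤ 2k, the angle jθ lies strictly between π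
and 2π, where the sine is negative. -/
lemma cheb_neg {x : ℝ} {j k : ℕ} (hk : 2 ≤ k) (hjk : j ≤ 2 * k) (hj : 1 ≤ j) (h1 : zeta k < x)
    (h2 : x < zeta j) : cheb x j < 0 := by
  obtain ⟨θ, h0, hpi, rfl⟩ := exists_angle ((neg_two_lt_zeta hk).trans h1)
    (h2.trans (zeta_lt_two hj))
  have h3 := (zeta_lt_iff (by omega) h0.le hpi.le).mp h1
  have h4 := (lt_zeta_iff hj h0.le hpi.le).mp h2
  have hjk' : (j : ℝ) ≤ 2 * k := by exact_mod_cast hjk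
  rw [cheb_eq_div (Real.sin_pos_of_pos_of_lt_pi h0 hpi).ne']
  refine div_neg_of_neg_of_pos ?_ (Real.sin_pos_of_pos_of_lt_pi h0 hpi)
  rw [← Real.sin_sub_two_pi]
  exact Real.sin_neg_of_neg_of_neg_pi_lt (by nlinarith) (by linarith)

lemma cheb_nonpos {x : ℝ} {j k : ℕ} (hk : 2 ≤ k) (hjk : j ≤ 2 * k) (hkj : k < j) (h1 : zeta k ≤ x)
    (h2 : x ≤ zeta j) : cheb x j ≤ 0 := by
  have hcl : IsClosed {x | cheb x j ≤ 0} := isClosed_le (continuous_cheb j) continuous_const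
  have hsub : Set.Ioo (zeta k) (zeta j) ⊆ {x | cheb x j ≤ 0} :=
    fun x hx => (cheb_neg hk hjk (by omega) hx.1 hx.2).le
  have := hcl.closure_subset_iff.mpr hsub
  rw [closure_Ioo (zeta_lt_zeta (by omega) hkj).ne] at this
  exact this ⟨h1, h2⟩

/-- Nonnegativity of S_k(x) alone would not suffice, as the sine recurs. By induction x is already
at least ζ_k, and on [ζ_k, ζ_{k+1}) the value S_{k+1}(x) is negative. -/
lemma zeta_le_of_cheb_nonneg {x : ℝ} {k : ℕ} (hk : 2 ≤ k) (h : ∀ j ≤ k, 0 ≤ cheb x j) :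
    zeta k ≤ x := by
  induction k, hk using Nat.le_induction with
  | base => simpa using h 2 le_rfl
  | succ k hk ih =>
    have h1 := ih (fun j hj => h j (by omega))
    by_contra! h2
    rcases h1.eq_or_lt with rfl | h1
    · have := h (k + 1) le_rfl
      rw [cheb_zeta_succ hk] at this
      linarith
    · exact absurd (h (k + 1) le_rfl) (cheb_neg hk (by omega) (by omega) h1 h2).not_ge

lemma le_zeta_of_cheb_nonpos {x : ℝ} {k : ℕ} (hk : 1 ≤ k) (h : cheb x k ≤ 0) : x ≤ zeta k := by
  by_contra! h2
  exact absurd h (cheb_pos hk h2).not_ge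

/-! ### Arcs in the parameter plane -/

lemma IsArcWithEndpoints.symm {S : Set (ℝ × ℝ)} {p q : ℝ × ℝ} (h : IsArcWithEndpoints S p q) :
    IsArcWithEndpoints S q p := by
  obtain ⟨γ, hc, hi, him, h0, h1⟩ := h
  have hm : Set.MapsTo (fun t : ℝ => 1 - t) (Set.Icc 0 1) (Set.Icc 0 1) :=
    fun t ht => ⟨by linarith [ht.2], by linarith [ht.1]⟩
  refine ⟨fun t => γ (1 - t), hc.comp (by fun_prop) hm, ?_, ?_, by simpa using h1,
    by simpa using h0⟩
  · intro s hs t ht hst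
    have := hi (hm hs) (hm ht) hst
    linarith
  · rw [← him]
    ext z
    constructor
    · rintro ⟨t, ht, rfl⟩
      exact ⟨1 - t, hm ht, rfl⟩
    · rintro ⟨t, ht, rfl⟩
      exact ⟨1 - t, hm ht, by simp⟩

lemma IsArcWithEndpoints.swap {S : Set (ℝ × ℝ)} {p q : ℝ × ℝ} (h : IsArcWithEndpoints S p q) :
    IsArcWithEndpoints (Prod.swap ⁻¹' S) p.swap q.swap := by
  obtain ⟨γ, hc, hi, him, h0, h1⟩ := h
  refine ⟨fun t => (γ t).swap, continuous_swap.comp_continuousOn hc, ?_, ?_, by simp [h0],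
    by simp [h1]⟩
  · intro s hs t ht hst
    exact hi hs ht (Prod.swap_injective hst)
  · rw [← him]
    ext z
    constructor
    · rintro ⟨t, ht, rfl⟩
      exact ⟨t, ht, by simp⟩
    · rintro ⟨t, ht, h⟩
      exact ⟨t, ht, by simp [h]⟩

/-- A closed strictly decreasing chain that projects onto an interval is an arc. -/
lemma isArc_of_antichain {S : Set (ℝ × ℝ)} {p q : ℝ × ℝ} (hS : IsClosed S) (hpq : p.1 < q.1)
    (hp : p ∈ S) (hq : q ∈ S) (hb : ∀ c ∈ S, p.1 ≤ c.1 ∧ c.1 ≤ q.1)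
    (hex : ∀ x, p.1 < x → x < q.1 → ∃ y, (x, y) ∈ S)
    (hanti : ∀ c ∈ S, ∀ c' ∈ S, c.1 ≤ c'.1 → c.2 ≤ c'.2 → c = c') :
    IsArcWithEndpoints S p q ∧ ∀ c ∈ S, q.2 ≤ c.2 ∧ c.2 ≤ p.2 := by
  -- A point below q or above p would be comparable with that end-point. This bounds S, and with
  -- closedness makes it compact.
  have hbd : ∀ c ∈ S, q.2 ≤ c.2 ∧ c.2 ≤ p.2 := by
    intro c hc
    constructor
    · by_contra! h
      rw [hanti c hc q hq (hb c hc).2 h.le] at h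
      exact lt_irrefl _ h
    · by_contra! h
      rw [← hanti p hp c hc (hb c hc).1 h.le] at h
      exact lt_irrefl _ h
  refine ⟨?_, hbd⟩
  have hcpt : IsCompact S := by
    refine (isCompact_Icc (a := p.1) (b := q.1)).prod (isCompact_Icc (a := q.2) (b := p.2))
      |>.of_isClosed_subset hS ?_
    exact fun c hc => ⟨hb c hc, hbd c hc⟩
  have : CompactSpace S := isCompact_iff_compactSpace.mp hcpt
  let π : S → Set.Icc p.1 q.1 := fun c => ⟨c.1.1, hb c.1 c.2⟩
  have hπ : Continuous π := by fun_prop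
  have hbij : Function.Bijective π := by
    constructor
    · intro c d hcd
      have h1 : c.1.1 = d.1.1 := congrArg Subtype.val hcd
      apply Subtype.ext
      rcases le_total c.1.2 d.1.2 with h | h
      · exact hanti _ c.2 _ d.2 h1.le h
      · exact (hanti _ d.2 _ c.2 h1.ge h).symm
    · rintro ⟨x, hx1, hx2⟩
      rcases hx1.eq_or_lt with rfl | hx1
      · exact ⟨⟨p, hp⟩, rfl⟩
      rcases hx2.eq_or_lt with rfl | hx2
      · exact ⟨⟨q, hq⟩, rfl⟩
      obtain ⟨y, hy⟩ := hex x hx1 hx2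
      exact ⟨⟨(x, y), hy⟩, rfl⟩
  let e : S ≃ₜ Set.Icc p.1 q.1 :=
    Continuous.homeoOfEquivCompactToT2 (f := Equiv.ofBijective π hbij) hπ
  have he : ∀ c : S, e c = π c := fun c => rfl
  have hd : 0 < q.1 - p.1 := sub_pos.mpr hpq
  let r : Set.Icc (0 : ℝ) 1 → Set.Icc p.1 q.1 := fun t =>
    ⟨p.1 + t * (q.1 - p.1), by nlinarith [t.2.1], by nlinarith [t.2.2]⟩
  have hr : Continuous r := by fun_prop
  have hval : ∀ t : ℝ, t ∈ Set.Icc (0 : ℝ) 1 →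
      (Set.projIcc (0 : ℝ) 1 zero_le_one t : ℝ) = t := fun t ht => by
    rw [Set.projIcc_of_mem _ ht]
  refine ⟨fun t => (e.symm (r (Set.projIcc 0 1 zero_le_one t)) : S), ?_, ?_, ?_, ?_, ?_⟩
  · have : Continuous fun t : ℝ => e.symm (r (Set.projIcc 0 1 zero_le_one t)) :=
      e.symm.continuous.comp (hr.comp continuous_projIcc)
    exact (continuous_subtype_val.comp this).continuousOn
  · intro s hs t ht hst
    have h1 := congrArg Subtype.val (e.symm.injective (Subtype.ext hst))
    simp only [r, hval s hs, hval t ht] at h1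
    have h2 : s * (q.1 - p.1) = t * (q.1 - p.1) := by linarith
    exact mul_right_cancel₀ hd.ne' h2
  · ext z
    constructor
    · rintro ⟨t, _, rfl⟩
      exact Subtype.coe_prop _
    · intro hz
      have hz1 := hb z hz
      refine ⟨(z.1 - p.1) / (q.1 - p.1), ⟨div_nonneg (by linarith) hd.le,
        (div_le_one hd).mpr (by linarith)⟩, ?_⟩
      have : r (Set.projIcc 0 1 zero_le_one ((z.1 - p.1) / (q.1 - p.1))) = e ⟨z, hz⟩ := by
        apply Subtype.ext
        simp only [r, he, π]
        rw [hval _ ⟨div_nonneg (by linarith) hd.le, (div_le_one hd).mpr (by linarith)⟩]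
        field_simp
        ring
      simp only [this, Homeomorph.symm_apply_apply]
  · have : r (Set.projIcc 0 1 zero_le_one 0) = e ⟨p, hp⟩ := by
      apply Subtype.ext
      simp only [r, he, π]
      rw [hval _ ⟨le_rfl, zero_le_one⟩]
      ring
    simp only [this, Homeomorph.symm_apply_apply]
  · have : r (Set.projIcc 0 1 zero_le_one 1) = e ⟨q, hq⟩ := by
      apply Subtype.ext
      simp only [r, he, π]
      rw [hval _ ⟨zero_le_one, le_rfl⟩]
      ring
    simp only [this, Homeomorph.symm_apply_apply]

/-! ### Counting factors and the symmetry z ↦ -z -/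

lemma factorCount_nil (x y : Letter) : factorCount [x, y] [] = 0 := by
  simp [factorCount]

lemma factorCount_singleton (x y p : Letter) : factorCount [x, y] [p] = 0 := by
  simp [factorCount, List.isPrefixOf]

lemma factorCount_cons_cons (x y p q : Letter) (w : Word) :
    factorCount [x, y] (p :: q :: w) =
      (if x = p ∧ y = q then 1 else 0) + factorCount [x, y] (q :: w) := by
  simp only [factorCount, List.tails_cons, List.countP_cons, List.isPrefixOf, Bool.and_true,
    Bool.and_eq_true, beq_iff_eq]
  omega

/-- The interchange of the two symbols. -/
def flip : Letter → Letter
  | Letter.a => Letter.b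
  | Letter.b => Letter.a

@[simp] lemma flip_a : flip Letter.a = Letter.b := rfl
@[simp] lemma flip_b : flip Letter.b = Letter.a := rfl
@[simp] lemma flip_flip (l : Letter) : flip (flip l) = l := by cases l <;> rfl
lemma flip_injective : Function.Injective flip :=
  Function.LeftInverse.injective flip_flip

lemma factorCount_map_flip (x y : Letter) (w : Word) :
    factorCount [flip x, flip y] (w.map flip) = factorCount [x, y] w := by
  induction w with
  | nil => simp [factorCount_nil]
  | cons p w ih =>
    cases w with
    | nil => simp [factorCount_singleton]
    | cons q w =>
      simp only [List.map_cons] at ih ⊢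
      rw [factorCount_cons_cons, factorCount_cons_cons, ih]
      simp [flip_injective.eq_iff]

/-- The factors ab and ba alternate along a word. The clauses on the first letter are the
strengthening that lets the induction run. -/
lemma factorCount_ab_ba (w : Word) :
    (factorCount [Letter.a, Letter.b] w ≤ factorCount [Letter.b, Letter.a] w + 1 ∧
      factorCount [Letter.b, Letter.a] w ≤ factorCount [Letter.a, Letter.b] w + 1) ∧
    (∀ v, w = Letter.a :: v →
      factorCount [Letter.b, Letter.a] w ≤ factorCount [Letter.a, Letter.b] w) ∧
    (∀ v, w = Letter.b :: v →
      factorCount [Letter.a, Letter.b] w ≤ factorCount [Letter.b, Letter.a] w) := by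
  induction w with
  | nil => simp [factorCount_nil]
  | cons p w ih =>
    cases w with
    | nil => simp [factorCount_singleton]
    | cons q w =>
      obtain ⟨⟨h1, h2⟩, h3, h4⟩ := ih
      rw [factorCount_cons_cons, factorCount_cons_cons]
      cases p <;> cases q <;> simp_all <;> omega

lemma code_zero (c z : ℝ × ℝ) : code c z 0 = [] := rfl

lemma code_succ (c z : ℝ × ℝ) (n : ℕ) : code c z (n + 1) = symbol z :: code c (F c z) n := by
  simp only [code, List.range_succ_eq_map, List.map_cons, List.map_map]
  rfl

lemma symbol_neg {z : ℝ × ℝ} (h : z ≠ 0) : symbol (-z) = flip (symbol z) := by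
  obtain ⟨x, y⟩ := z
  unfold symbol
  rcases lt_trichotomy x 0 with hx | rfl | hx
  · simp [hx, hx.not_gt, hx.ne]
  · have hy : y ≠ 0 := fun hy => h (by simp [hy])
    rcases hy.lt_or_gt with hy | hy
    · simp [hy.le, hy.not_ge]
    · simp [hy.le, hy.not_ge]
  · simp [hx, hx.not_gt, hx.ne']

lemma param_swap_flip (c : ℝ × ℝ) (l : Letter) : param c.swap (flip l) = param c l := by
  cases l <;> rfl

/-- The origin is excluded because it is its own negative but carries the fixed symbol a; every
other point and its negative have opposite symbols. -/
lemma F_swap_neg (c : ℝ × ℝ) {z : ℝ × ℝ} (h : z ≠ 0) : F c.swap (-z) = -F c z := by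
  simp only [F, symbol_neg h, param_swap_flip]
  ext <;> simp
  ring

lemma F_ne_zero (c : ℝ × ℝ) {z : ℝ × ℝ} (h : z ≠ 0) : F c z ≠ 0 := by
  intro h0
  have h2 : z.1 = 0 := congrArg Prod.snd h0
  have h1 : param c (symbol z) * z.1 - z.2 = 0 := congrArg Prod.fst h0
  rw [h2] at h1
  exact h (Prod.ext h2 (by simpa using h1))

lemma iterate_F_swap_neg (c : ℝ × ℝ) {z : ℝ × ℝ} (h : z ≠ 0) (t : ℕ) :
    (F c.swap)^[t] (-z) = -(F c)^[t] z := by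
  induction t generalizing z with
  | zero => rfl
  | succ t ih => rw [Function.iterate_succ_apply, F_swap_neg c h, ih (F_ne_zero c h),
      Function.iterate_succ_apply]

lemma iterate_F_ne_zero (c : ℝ × ℝ) {z : ℝ × ℝ} (h : z ≠ 0) (t : ℕ) : (F c)^[t] z ≠ 0 := by
  induction t generalizing z with
  | zero => exact h
  | succ t ih => rw [Function.iterate_succ_apply]; exact ih (F_ne_zero c h)

lemma code_swap_neg (c : ℝ × ℝ) {z : ℝ × ℝ} (h : z ≠ 0) (n : ℕ) :
    code c.swap (-z) n = (code c z n).map flip := by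
  simp only [code, List.map_map]
  refine List.map_congr_left fun t _ => ?_
  rw [iterate_F_swap_neg c h, symbol_neg (iterate_F_ne_zero c h t)]
  rfl

/-! ### Rotation numbers -/

/-- The number of occurrences of `ab` in the code grows linearly up to a bounded error. -/
def LinearCount (c : ℝ × ℝ) (K : ℝ) (z : ℝ × ℝ) : Prop :=
  ∃ C, ∀ n : ℕ, |(n : ℝ) - K * factorCount [Letter.a, Letter.b] (code c z n)| ≤ C

lemma hasRotationNumber_of_linearCount {c : ℝ × ℝ} {K : ℝ} (hK : 0 < K)
    (h : ∀ z, z ≠ 0 → LinearCount c K z) : HasRotationNumber c (1 / K) := by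
  intro z hz
  obtain ⟨C, hC⟩ := h z hz
  have h0 : Tendsto (fun n : ℕ => C / K / (n : ℝ)) atTop (𝓝 0) :=
    tendsto_const_div_atTop_nhds_zero_nat _
  rw [tendsto_iff_dist_tendsto_zero]
  refine squeeze_zero' (Eventually.of_forall fun n => dist_nonneg) ?_ h0
  filter_upwards [eventually_gt_atTop 0] with n hn
  have hn' : (0 : ℝ) < n := by exact_mod_cast hn
  rw [Real.dist_eq, show (factorCount [Letter.a, Letter.b] (code c z n) : ℝ) / n - 1 / K =
    -(((n : ℝ) - K * factorCount [Letter.a, Letter.b] (code c z n)) / K / n) by field_simp; ring,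
    abs_neg, abs_div, abs_div, abs_of_pos hn', abs_of_pos hK]
  gcongr
  exact hC n

/-- The symmetry turns occurrences of ab into occurrences of ba. The two counts differ by at most 1,
which disappears after division by n. -/
lemma HasRotationNumber.swap {c : ℝ × ℝ} {θ : ℝ} (h : HasRotationNumber c θ) :
    HasRotationNumber c.swap θ := by
  intro z hz
  have h1 := h (-z) (neg_ne_zero.mpr hz)
  have h0 : Tendsto (fun n : ℕ => (1 : ℝ) / n) atTop (𝓝 0) :=
    tendsto_const_div_atTop_nhds_zero_nat _
  have hd : Tendsto (fun n : ℕ =>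
      (factorCount [Letter.a, Letter.b] (code c.swap z n) : ℝ) / n -
        (factorCount [Letter.a, Letter.b] (code c (-z) n) : ℝ) / n) atTop (𝓝 0) := by
    rw [tendsto_zero_iff_abs_tendsto_zero]
    refine squeeze_zero (fun n => abs_nonneg _) (fun n => ?_) h0
    simp only [Function.comp_apply]
    rw [← sub_div, abs_div, Nat.abs_cast]
    gcongr
    have e := code_swap_neg c (neg_ne_zero.mpr hz) n
    rw [neg_neg] at e
    rw [e]
    have e2 := factorCount_map_flip Letter.b Letter.a (code c (-z) n)
    simp only [flip_a, flip_b] at e2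
    rw [e2]
    obtain ⟨⟨h1, h2⟩, -⟩ := factorCount_ab_ba (code c (-z) n)
    have h1' : (factorCount [Letter.a, Letter.b] (code c (-z) n) : ℝ) ≤
      factorCount [Letter.b, Letter.a] (code c (-z) n) + 1 := by exact_mod_cast h1
    have h2' : (factorCount [Letter.b, Letter.a] (code c (-z) n) : ℝ) ≤
      factorCount [Letter.a, Letter.b] (code c (-z) n) + 1 := by exact_mod_cast h2
    rw [abs_le]
    constructor <;> linarith
  simpa using hd.add h1

lemma factorCount_code_succ (c z : ℝ × ℝ) (n : ℕ) :
    factorCount [Letter.a, Letter.b] (code c z (n + 2)) =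
      (if Letter.a = symbol z ∧ Letter.b = symbol (F c z) then 1 else 0) +
        factorCount [Letter.a, Letter.b] (code c (F c z) (n + 1)) := by
  rw [code_succ, code_succ, factorCount_cons_cons]

/-- A bounded potential that increases by `1` in each step, and by `1 - K` at each change
from `a` to `b`, counts the occurrences of `ab`. -/
lemma linearCount_of_potential {c : ℝ × ℝ} {K C : ℝ} {I : ℝ × ℝ → ℝ → Prop}
    (hb : ∀ z φ, I z φ → |φ| ≤ C)
    (hstep : ∀ z φ, I z φ → I (F c z) (φ + 1 -
      K * (if Letter.a = symbol z ∧ Letter.b = symbol (F c z) then 1 else 0)))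
    {z : ℝ × ℝ} {φ : ℝ} (hz : I z φ) : LinearCount c K z := by
  have key : ∀ n : ℕ, ∀ z φ, I z φ →
      |(n : ℝ) - K * factorCount [Letter.a, Letter.b] (code c z n) + φ| ≤ C + 1 := by
    intro n
    induction n with
    | zero =>
      intro z φ h
      simp only [code_zero, factorCount_nil]
      have := hb z φ h
      simp
      linarith
    | succ n ih =>
      intro z φ h
      cases n with
      | zero =>
        have := hb z φ h
        simp only [code_succ, code_zero, factorCount_singleton]
        rw [abs_le] at this ⊢
        push_cast
        constructor <;> linarith
      | succ n =>
        have := ih _ _ (hstep z φ h)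
        rw [factorCount_code_succ]
        convert this using 2
        push_cast
        ring
  refine ⟨C + 1 + C, fun n => ?_⟩
  have h1 := key n z φ hz
  have h2 := hb z φ hz
  rw [abs_le] at h1 h2 ⊢
  constructor <;> linarith

lemma LinearCount.of_F {c : ℝ × ℝ} {K : ℝ} {z : ℝ × ℝ} (h : LinearCount c K (F c z)) :
    LinearCount c K z := by
  obtain ⟨C, hC⟩ := h
  have hC0 := (abs_nonneg _).trans (hC 0)
  refine ⟨C + 1 + |K|, fun n => ?_⟩
  rcases n with _ | _ | n
  · simp only [code_zero, factorCount_nil]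
    simp
    linarith [abs_nonneg K]
  · simp only [code_succ, code_zero, factorCount_singleton]
    simp
    linarith [abs_nonneg K]
  · have := hC (n + 1)
    rw [factorCount_code_succ]
    have h1 := neg_abs_le K
    have h2 := le_abs_self K
    have h3 := abs_nonneg K
    rw [abs_le] at this ⊢
    push_cast at this ⊢
    split_ifs <;> constructor <;> linarith

lemma LinearCount.of_iterate {c : ℝ × ℝ} {K : ℝ} {z : ℝ × ℝ} {t : ℕ}
    (h : LinearCount c K ((F c)^[t] z)) : LinearCount c K z := by
  induction t generalizing z with
  | zero => exact h
  | succ t ih => exact (ih h).of_F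

lemma symbol_eq_b {z : ℝ × ℝ} (h : z.1 < 0 ∨ (z.1 = 0 ∧ 0 < z.2)) : symbol z = Letter.b := by
  unfold symbol
  rcases h with h | h
  · simp [h.not_gt, h.ne]
  · simp [h.1, h.2]

lemma symbol_eq_a {z : ℝ × ℝ} (h : 0 < z.1 ∨ (z.1 = 0 ∧ z.2 ≤ 0)) : symbol z = Letter.a := by
  simp [symbol, h]

lemma symbol_eq_b_iff {z : ℝ × ℝ} :
    symbol z = Letter.b ↔ z.1 < 0 ∨ (z.1 = 0 ∧ 0 < z.2) := by
  refine ⟨fun h => ?_, symbol_eq_b⟩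
  by_contra! h'
  have := symbol_eq_a (z := z) (by
    rcases h'.1.eq_or_lt with h1 | h1
    · exact Or.inr ⟨h1.symm, h'.2 h1.symm⟩
    · exact Or.inl h1)
  rw [h] at this
  cases this

/-- The points of the left half-plane in polar coordinates adapted to the rotation. -/
lemma exists_polar {β : ℝ} (h0 : 0 < β) (h1 : β < Real.pi) {z : ℝ × ℝ}
    (hz : symbol z = Letter.b) :
    ∃ r θ, 0 < r ∧ 0 ≤ θ ∧ θ < Real.pi ∧ z = (-(r * Real.sin θ), -(r * Real.sin (θ - β))) := by
  have hs := Real.sin_pos_of_pos_of_lt_pi h0 h1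
  rw [symbol_eq_b_iff] at hz
  -- The imaginary part gives r sin θ = -x, and the real part is chosen so that r sin (θ - β) = -y.
  -- The tie-breaking rule for the symbol on the axis keeps θ = 0 and excludes θ = π.
  set w : ℂ := ⟨(z.2 - z.1 * Real.cos β) / Real.sin β, -z.1⟩ with hw
  have hne : w ≠ 0 := by
    intro h
    have h2 : -z.1 = 0 := congrArg Complex.im h
    have h3 : (z.2 - z.1 * Real.cos β) / Real.sin β = 0 := congrArg Complex.re h
    rcases hz with hz | hz
    · linarith
    · rw [hz.1] at h3
      simp [hs.ne', hz.2.ne'] at h3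
  refine ⟨‖w‖, w.arg, norm_pos_iff.mpr hne, ?_, ?_, ?_⟩
  · rw [Complex.arg_nonneg_iff]
    change 0 ≤ -z.1
    rcases hz with hz | hz <;> linarith [hz]
  · refine lt_of_le_of_ne (Complex.arg_le_pi w) fun h => ?_
    rw [Complex.arg_eq_pi_iff] at h
    have h2 : -z.1 = 0 := h.2
    have h3 : (z.2 - z.1 * Real.cos β) / Real.sin β < 0 := h.1
    have h4 : z.1 = 0 := by linarith
    rw [h4] at h3
    have : 0 < z.2 := by
      rcases hz with hz | hz
      · linarith
      · exact hz.2
    have : 0 ≤ (z.2 - 0 * Real.cos β) / Real.sin β := by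
      apply div_nonneg _ hs.le
      linarith
    linarith
  · rw [Real.sin_sub, mul_sub, ← mul_assoc, ← mul_assoc, Complex.norm_mul_sin_arg,
      Complex.norm_mul_cos_arg]
    ext
    · simp [hw]
    · simp only [hw]
      field_simp
      ring

/-- The states of an orbit for the parameters `(ζ_k, 2 cos β)` with their potentials. -/
inductive RotState (k : ℕ) (β : ℝ) : ℝ × ℝ → ℝ → Prop
  | left (r θ : ℝ) (hr : 0 < r) (h0 : 0 ≤ θ) (h1 : θ < Real.pi) :
      RotState k β (-(r * Real.sin θ), -(r * Real.sin (θ - β))) (θ / β)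
  | right (r θ : ℝ) (j : ℕ) (hr : 0 < r) (h0 : 0 ≤ θ) (h1 : θ < β) (hj : j < k) :
      RotState k β
        (r * Real.sin θ * cheb (zeta k) (j + 1) - r * Real.sin (θ - β) * cheb (zeta k) j,
          r * Real.sin θ * cheb (zeta k) j - r * Real.sin (θ - β) *
            (zeta k * cheb (zeta k) j - cheb (zeta k) (j + 1)))
        ((Real.pi + θ) / β + j)

lemma symbol_left {β r θ : ℝ} (hβ : 0 < β) (hβ1 : β < Real.pi) (hr : 0 < r) (h0 : 0 ≤ θ)
    (h1 : θ < Real.pi) :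
    symbol (-(r * Real.sin θ), -(r * Real.sin (θ - β))) = Letter.b := by
  apply symbol_eq_b
  rcases h0.eq_or_lt with rfl | h0
  · right
    simpa using mul_pos hr (Real.sin_pos_of_pos_of_lt_pi hβ hβ1)
  · left
    simpa using mul_pos hr (Real.sin_pos_of_pos_of_lt_pi h0 h1)

/-- Since sin θ ≥ 0 > sin (θ - β), both terms of the abscissa are nonnegative, and the second is
positive for 0 < j < k. The case j = 0, θ = 0 is a point of the negative ordinate half-axis, which
belongs to a. -/
lemma symbol_right {k j : ℕ} (hk : 2 ≤ k) {β r θ : ℝ} (hβ1 : β < Real.pi) (hr : 0 < r)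
    (h0 : 0 ≤ θ) (h1 : θ < β) (hj : j < k) :
    symbol (r * Real.sin θ * cheb (zeta k) (j + 1) - r * Real.sin (θ - β) * cheb (zeta k) j,
          r * Real.sin θ * cheb (zeta k) j - r * Real.sin (θ - β) *
            (zeta k * cheb (zeta k) j - cheb (zeta k) (j + 1))) = Letter.a := by
  have hs : 0 ≤ r * Real.sin θ :=
    mul_nonneg hr.le (Real.sin_nonneg_of_nonneg_of_le_pi h0 (by linarith))
  have hs' : r * Real.sin (θ - β) < 0 :=
    mul_neg_of_pos_of_neg hr (Real.sin_neg_of_neg_of_neg_pi_lt (by linarith) (by linarith))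
  apply symbol_eq_a
  rcases Nat.eq_zero_or_pos j with rfl | hj0
  · rcases hs.eq_or_lt with hs | hs
    · right
      rw [← hs]
      simpa using hs'.le
    · left
      simpa using hs
  · left
    have e1 := cheb_nonneg hk le_rfl (i := j + 1) (by omega)
    have e2 := cheb_pos hj0 (zeta_lt_zeta hj0 hj)
    have e3 := mul_nonneg hs e1
    have e4 := mul_neg_of_neg_of_pos hs' e2
    simp only
    linarith

/-- Each step on the left advances θ by β. After k steps on the right the entry point has been
negated, so the orbit is on the left with the same θ. Exactly there ab occurs, and the potential
drops by k + π/β. -/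
lemma rotState_step {k : ℕ} (hk : 2 ≤ k) {β : ℝ} (hβ : 0 < β) (hβ1 : β < Real.pi) (z : ℝ × ℝ)
    (φ : ℝ) (h : RotState k β z φ) :
    RotState k β (F (zeta k, 2 * Real.cos β) z) (φ + 1 - (k + Real.pi / β) *
      (if Letter.a = symbol z ∧ Letter.b = symbol (F (zeta k, 2 * Real.cos β) z) then 1 else 0)) := by
  cases h with
  | left r θ hr h0 h1 =>
    have hF : F (zeta k, 2 * Real.cos β) (-(r * Real.sin θ), -(r * Real.sin (θ - β))) =
        (-(r * Real.sin (θ + β)), -(r * Real.sin (θ + β - β))) := by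
      rw [F, symbol_left hβ hβ1 hr h0 h1, add_sub_cancel_right, Real.sin_add, Real.sin_sub]
      simp only [param]
      ext <;> simp
      ring
    rw [symbol_left hβ hβ1 hr h0 h1, hF]
    simp only [reduceCtorEq, false_and, if_false, mul_zero, sub_zero]
    rcases lt_or_ge (θ + β) Real.pi with h2 | h2
    · convert RotState.left (k := k) (β := β) r (θ + β) hr (by linarith) h2 using 1
      field_simp
    · convert RotState.right (k := k) (β := β) r (θ + β - Real.pi) 0 hr (by linarith) (by linarith)
        (by omega) using 1
      · ext <;> simp [Real.sin_sub_pi,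
          show θ + β - Real.pi - β = θ - Real.pi by ring]
      · field_simp
        simp
  | right r θ j hr h0 h1 hj =>
    have hF : F (zeta k, 2 * Real.cos β) (r * Real.sin θ * cheb (zeta k) (j + 1) -
          r * Real.sin (θ - β) * cheb (zeta k) j,
          r * Real.sin θ * cheb (zeta k) j - r * Real.sin (θ - β) *
            (zeta k * cheb (zeta k) j - cheb (zeta k) (j + 1))) =
        (r * Real.sin θ * cheb (zeta k) (j + 2) - r * Real.sin (θ - β) * cheb (zeta k) (j + 1),
          r * Real.sin θ * cheb (zeta k) (j + 1) - r * Real.sin (θ - β) * cheb (zeta k) j) := by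
      rw [F, symbol_right hk hβ1 hr h0 h1 hj, cheb_add_two]
      simp only [param]
      ext <;> simp
      ring
    rw [symbol_right hk hβ1 hr h0 h1 hj, hF]
    rcases Nat.lt_or_ge (j + 1) k with h2 | h2
    · have hz : (r * Real.sin θ * cheb (zeta k) (j + 2) -
            r * Real.sin (θ - β) * cheb (zeta k) (j + 1),
          r * Real.sin θ * cheb (zeta k) (j + 1) - r * Real.sin (θ - β) * cheb (zeta k) j) =
          (r * Real.sin θ * cheb (zeta k) (j + 1 + 1) -
            r * Real.sin (θ - β) * cheb (zeta k) (j + 1),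
          r * Real.sin θ * cheb (zeta k) (j + 1) - r * Real.sin (θ - β) *
            (zeta k * cheb (zeta k) (j + 1) - cheb (zeta k) (j + 1 + 1))) := by
        rw [show j + 1 + 1 = j + 2 by ring, cheb_add_two]
        ext <;> simp
      rw [hz, symbol_right hk hβ1 hr h0 h1 h2]
      convert RotState.right (k := k) (β := β) r θ (j + 1) hr h0 h1 h2 using 1
      simp
      ring
    · obtain rfl : k = j + 1 := by omega
      have hz : (r * Real.sin θ * cheb (zeta (j + 1)) (j + 2) -
            r * Real.sin (θ - β) * cheb (zeta (j + 1)) (j + 1),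
          r * Real.sin θ * cheb (zeta (j + 1)) (j + 1) -
            r * Real.sin (θ - β) * cheb (zeta (j + 1)) j) =
          (-(r * Real.sin θ), -(r * Real.sin (θ - β))) := by
        have e1 := cheb_zeta_self hk
        have e2 := cheb_zeta_succ hk
        have e3 := cheb_zeta_pred hk
        rw [show j + 1 + 1 = j + 2 by ring] at e2
        rw [show j + 1 - 1 = j by omega] at e3
        rw [e1, e2, e3]
        ext <;> simp
      rw [hz, symbol_left hβ hβ1 hr h0 (by linarith)]
      convert RotState.left (k := j + 1) (β := β) r θ hr h0 (by linarith) using 1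
      simp
      field_simp
      ring

lemma rotState_bound {k : ℕ} {β : ℝ} (hβ : 0 < β) (z : ℝ × ℝ) (φ : ℝ) (h : RotState k β z φ) :
    |φ| ≤ Real.pi / β + 1 + k := by
  have hp := Real.pi_pos
  cases h with
  | left r θ hr h0 h1 =>
    rw [abs_of_nonneg (by positivity)]
    have : θ / β ≤ Real.pi / β := by gcongr
    have : (0 : ℝ) ≤ k := by positivity
    linarith
  | right r θ j hr h0 h1 hj =>
    rw [abs_of_nonneg (by positivity), add_div]
    have : θ / β ≤ 1 := by rw [div_le_one hβ]; exact h1.le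
    have : (j : ℝ) ≤ k := by exact_mod_cast hj.le
    linarith

/-- Orbits in the right half-plane for `a = ζ_k`. -/
lemma iterate_F_right {c : ℝ × ℝ} {z : ℝ × ℝ} (t : ℕ)
    (h : ∀ s < t, symbol ((F c)^[s] z) = Letter.a) :
    (F c)^[t] z = (z.1 * cheb c.1 (t + 1) - z.2 * cheb c.1 t,
      z.1 * cheb c.1 t - z.2 * (c.1 * cheb c.1 t - cheb c.1 (t + 1))) := by
  induction t with
  | zero => simp
  | succ t ih =>
    rw [Function.iterate_succ_apply', F, h t (by omega), ih (fun s hs => h s (by omega)),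
      cheb_add_two]
    simp only [param]
    ext <;> simp
    ring

/-- If one half-plane is a half-turn, the map has a rotation number. -/
lemma hasRotationNumber_zeta {k : ℕ} (hk : 2 ≤ k) {β : ℝ} (hβ : 0 < β) (hβ1 : β < Real.pi) :
    HasRotationNumber (zeta k, 2 * Real.cos β) (1 / (k + Real.pi / β)) := by
  have hp := Real.pi_pos
  refine hasRotationNumber_of_linearCount (by positivity) fun z hz => ?_
  have hb : ∀ z, symbol z = Letter.b →
      LinearCount (zeta k, 2 * Real.cos β) (k + Real.pi / β) z := by
    intro z hz
    obtain ⟨r, θ, hr, h0, h1, rfl⟩ := exists_polar hβ hβ1 hz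
    exact linearCount_of_potential (rotState_bound hβ) (rotState_step hk hβ hβ1)
      (RotState.left (k := k) r θ hr h0 h1)
  by_cases h : ∃ t, symbol ((F (zeta k, 2 * Real.cos β))^[t] z) = Letter.b
  · obtain ⟨t, ht⟩ := h
    exact (hb _ ht).of_iterate
  · push Not at h
    have ha : ∀ t, symbol ((F (zeta k, 2 * Real.cos β))^[t] z) = Letter.a := by
      intro t
      have := h t
      cases hs : symbol ((F (zeta k, 2 * Real.cos β))^[t] z) with
      | a => rfl
      | b => exact absurd hs this
    -- An orbit that never left the right half-plane would reach -z after k steps, whose symbol is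
    -- b.
    have e := iterate_F_right k (fun s _ => ha s)
    rw [cheb_zeta_self hk, cheb_zeta_succ hk] at e
    have hneg : (F (zeta k, 2 * Real.cos β))^[k] z = -z := by
      rw [e]
      ext <;> simp
    have h1 := ha k
    rw [hneg, symbol_neg hz, show symbol z = Letter.a from ha 0] at h1
    cases h1

/-! ### Ranks and letters of the words -/

lemma wa_succ (n : ℕ) : wa (n + 1) = Letter.a :: wa n := rfl
lemma wb_succ (n : ℕ) : wb (n + 1) = Letter.b :: wb n := rfl
lemma wpow_zero (w : Word) : wpow w 0 = [] := rfl
lemma wpow_succ (w : Word) (m : ℕ) : wpow w (m + 1) = w ++ wpow w m := by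
  simp [wpow, List.replicate_succ]

lemma map_flip_wa (n : ℕ) : (wa n).map flip = wb n := by simp [wa, wb]
lemma map_flip_wb (n : ℕ) : (wb n).map flip = wa n := by simp [wa, wb]
lemma map_flip_wpow (w : Word) (m : ℕ) : (wpow w m).map flip = wpow (w.map flip) m := by
  induction m with
  | zero => rfl
  | succ m ih => rw [wpow_succ, wpow_succ, List.map_append, ih]

lemma wpow_append_comm (u v : Word) (m : ℕ) : u ++ wpow (v ++ u) m = wpow (u ++ v) m ++ u := by
  induction m with
  | zero => simp [wpow_zero]
  | succ m ih => rw [wpow_succ, wpow_succ, List.append_assoc v u, ih]; simp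

lemma rank_map_flip (w : Word) : rank (w.map flip) = rank w := by
  have h1 := factorCount_map_flip Letter.a Letter.b w
  have h2 := factorCount_map_flip Letter.b Letter.a w
  simp only [flip_a, flip_b] at h1 h2
  unfold rank
  omega

lemma rank_cons_cons (p q : Letter) (w : Word) :
    rank (p :: q :: w) = (if p = q then 0 else 1) + rank (q :: w) := by
  unfold rank
  rw [factorCount_cons_cons, factorCount_cons_cons]
  cases p <;> cases q <;> simp <;> omega

lemma rank_wa_append (n : ℕ) (w : Word) : rank (wa n ++ Letter.a :: w) = rank (Letter.a :: w) := by
  induction n with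
  | zero => rfl
  | succ n ih =>
    rw [wa_succ, List.cons_append]
    cases n with
    | zero => rw [← ih]; simp [wa, rank_cons_cons]
    | succ n => rw [← ih, wa_succ, List.cons_append, rank_cons_cons]; simp

lemma rank_wb_append (n : ℕ) (w : Word) : rank (wb n ++ Letter.b :: w) = rank (Letter.b :: w) := by
  have := rank_map_flip (wb n ++ Letter.b :: w)
  simp only [List.map_append, map_flip_wb, List.map_cons, flip_b] at this
  rw [← this, rank_wa_append, ← rank_map_flip (Letter.b :: w)]
  rfl

lemma wa_succ' (n : ℕ) : wa (n + 1) = wa n ++ [Letter.a] := by simp [wa, List.replicate_succ']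
lemma wb_succ' (n : ℕ) : wb (n + 1) = wb n ++ [Letter.b] := by simp [wb, List.replicate_succ']

lemma rank_singleton (p : Letter) : rank [p] = 1 := by
  simp [rank, factorCount_singleton]

lemma rank_wa_wb (i j : ℕ) : rank (wa (i + 1) ++ wb (j + 1)) = 2 := by
  rw [wa_succ', List.append_assoc, List.singleton_append, rank_wa_append, wb_succ, rank_cons_cons,
    ← wb_succ, wb_succ', rank_wb_append, rank_singleton]
  simp

lemma rank_periodic (i j k m : ℕ) :
    rank (wpow (wa (i + 1) ++ wb (j + 1)) m ++ wa (k + 1)) = 2 * m + 1 := by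
  induction m with
  | zero => rw [wpow_zero, List.nil_append, wa_succ', rank_wa_append, rank_singleton]
  | succ m ih =>
    have hv : ∃ v, wpow (wa (i + 1) ++ wb (j + 1)) m ++ wa (k + 1) = Letter.a :: v := by
      cases m with
      | zero => exact ⟨_, rfl⟩
      | succ m => rw [wpow_succ, wa_succ]; exact ⟨_, rfl⟩
    obtain ⟨v, hv⟩ := hv
    rw [wpow_succ, List.append_assoc, hv, wa_succ', List.append_assoc, List.append_assoc,
      List.singleton_append, rank_wa_append, wb_succ, List.cons_append, rank_cons_cons,
      ← List.cons_append, ← wb_succ, wb_succ', List.append_assoc, List.singleton_append,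
      rank_wb_append, rank_cons_cons, ← hv, ih]
    simp
    omega

/-- The periodic sequence of letters with `i` letters `a` in each period `p`, shifted by `s`. -/
def blockLetter (i p s t : ℕ) : Letter := if (t + s) % p < i then Letter.a else Letter.b

lemma length_periodic (i j k m : ℕ) :
    (wpow (wa i ++ wb j) m ++ wa k).length = m * (i + j) + k := by
  simp [wpow, wa, wb]

lemma getElem_periodic {i j k : ℕ} (hk : k ≤ i) (m t : ℕ)
    (ht : t < (wpow (wa i ++ wb j) m ++ wa k).length) :
    (wpow (wa i ++ wb j) m ++ wa k)[t] = blockLetter i (i + j) 0 t := by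
  unfold blockLetter
  rw [add_zero]
  induction m generalizing t with
  | zero =>
    have h1 : t < k := by simpa [wpow_zero, wa] using ht
    simp only [wpow_zero, List.nil_append]
    rw [Nat.mod_eq_of_lt (by omega), if_pos (by omega)]
    simp [wa]
  | succ m ih =>
    simp only [wpow_succ, List.append_assoc (wa i ++ wb j)]
    rw [length_periodic] at ht
    rcases Nat.lt_or_ge t (i + j) with h | h
    · rw [List.getElem_append_left (by simpa [wa, wb] using h), Nat.mod_eq_of_lt h]
      split_ifs with h1
      · rw [List.getElem_append_left (by simpa [wa] using h1)]
        simp [wa]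
      · rw [List.getElem_append_right (by simpa [wa] using h1)]
        simp [wb]
    · have e : (wa i ++ wb j).length = i + j := by simp [wa, wb]
      rw [List.getElem_append_right (by omega)]
      have := ih (t - (wa i ++ wb j).length) (by
        rw [length_periodic, e]
        have : (m + 1) * (i + j) = m * (i + j) + (i + j) := by ring
        omega)
      rw [this, e, Nat.mod_eq_sub_mod h]

lemma getElem_cons_periodic {i j k : ℕ} (hk : k ≤ i) (hi : 1 ≤ i) (m t : ℕ)
    (ht : t < (Letter.a :: (wpow (wa i ++ wb j) m ++ wa k)).length) (h1 : 1 ≤ t) :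
    (Letter.a :: (wpow (wa i ++ wb j) m ++ wa k))[t] = blockLetter i (i + j) (i + j - 1) t := by
  obtain ⟨s, rfl⟩ := Nat.exists_eq_add_of_le' h1
  rw [List.getElem_cons_succ, getElem_periodic hk]
  unfold blockLetter
  rw [show s + 1 + (i + j - 1) = s + (i + j) by omega, Nat.add_mod_right, add_zero]

/-! ### The symmetry on curves and legal arcs -/

lemma Legal.swap {w : Word} {c : ℝ × ℝ} (h : Legal w c) (hw : w ≠ []) :
    Legal (w.map flip) c.swap := by
  have hs0 : start w ≠ 0 := by
    unfold start
    split <;> simp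
  have hs : start (w.map flip) = -start w := by
    cases w with
    | nil => exact absurd rfl hw
    | cons l w => cases l <;> simp [start]
  unfold Legal at h ⊢
  rw [hs]
  refine ⟨?_, fun t => ?_⟩
  · rw [List.length_map, iterate_F_swap_neg c hs0, Prod.fst_neg, h.1, neg_zero]
  · have ht : (t : ℕ) < w.length := by simpa using t.2
    rw [iterate_F_swap_neg c hs0, Prod.fst_neg, neg_eq_zero,
      symbol_neg (iterate_F_ne_zero c hs0 _)]
    rcases h.2 ⟨t, ht⟩ with h | h
    · exact Or.inl h
    · right
      have h' : symbol ((F c)^[(t : ℕ)] (start w)) = w[(t : ℕ)] := h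
      rw [h']
      simp

lemma map_flip_flip (w : Word) : (w.map flip).map flip = w := by
  simp [Function.comp_def]

lemma legal_swap_iff {w : Word} {c : ℝ × ℝ} (hw : w ≠ []) :
    Legal (w.map flip) c.swap ↔ Legal w c := by
  refine ⟨fun h => ?_, fun h => h.swap hw⟩
  have := h.swap (by simpa using hw)
  rwa [map_flip_flip, Prod.swap_swap] at this

lemma getD_map_flip {w : Word} {t : ℕ} (ht : t < w.length) :
    (w.map flip).getD t Letter.a = flip (w.getD t Letter.a) := by
  rw [List.getD_eq_getElem _ _ (by simpa using ht), List.getD_eq_getElem _ _ ht, List.getElem_map]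

lemma aeval_Q_map_flip {w : Word} {c : ℝ × ℝ} {t : ℕ} (ht : t ≤ w.length) :
    MvPolynomial.aeval (param c.swap) (Q (w.map flip) t) =
      MvPolynomial.aeval (param c) (Q w t) := by
  induction t using Nat.twoStepInduction with
  | zero => simp [Q]
  | one => simp [Q]
  | more t h1 h2 =>
    rw [Q, Q, map_sub, map_sub, map_mul, map_mul, h1 (by omega), h2 (by omega),
      MvPolynomial.aeval_X, MvPolynomial.aeval_X, getD_map_flip (by omega), param_swap_flip]

lemma mem_curve_swap_iff {w : Word} {c : ℝ × ℝ} (hw : 2 ≤ w.length) :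
    c.swap ∈ curve (w.map flip) ↔ c ∈ curve w := by
  simp only [curve, curvePoly, Set.mem_ofPred_eq, rank_map_flip, List.length_map]
  split_ifs
  · rw [map_sub, map_sub, aeval_Q_map_flip (by omega), aeval_Q_map_flip (by omega)]
  · rw [map_sub, map_sub, aeval_Q_map_flip (by omega), aeval_Q_map_flip (by omega)]
  · rw [aeval_Q_map_flip le_rfl]

lemma legalArc_map_flip {w : Word} (hw : 2 ≤ w.length) :
    legalArc (w.map flip) = Prod.swap ⁻¹' legalArc w := by
  have hne : w ≠ [] := by rintro rfl; simp at hw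
  ext c
  have h1 := mem_curve_swap_iff (c := c.swap) hw
  have h2 := legal_swap_iff (c := c.swap) hne
  rw [Prod.swap_swap] at h1 h2
  simp only [legalArc, Set.mem_ofPred_eq, Set.mem_preimage, h1, h2]

lemma IsCriticalCurveWithEndpoints.map_flip {w : Word} {m : ℕ} {e e' : ℝ × ℝ} {θ θ' : ℝ}
    (h : IsCriticalCurveWithEndpoints w m e e' θ θ') (hw : 2 ≤ w.length) :
    IsCriticalCurveWithEndpoints (w.map flip) m e.swap e'.swap θ θ' := by
  obtain ⟨h1, h2, h3, h4, h5⟩ := h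
  refine ⟨by rw [rank_map_flip, h1], ?_, ?_, h4.swap, h5.swap⟩
  · rw [legalArc_map_flip hw]
    exact fun c hc => (h2 hc).symm
  · rw [legalArc_map_flip hw]
    exact h3.swap

/-! ### Periodic coefficients -/

/-- The trace of the transfer matrix over `p` steps. -/
def tau (P : ℕ → ℝ) (p : ℕ) : ℝ := cont P (p + 1) - cont (fun s => P (s + 1)) (p - 1)

/-- Each one-step transfer matrix has determinant 1, hence so does every product of them. -/
lemma cont_det (P : ℕ → ℝ) (t : ℕ) :
    cont P (t + 2) * cont (fun s => P (s + 1)) t -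
      cont P (t + 1) * cont (fun s => P (s + 1)) (t + 1) = -1 := by
  induction t with
  | zero => simp
  | succ t ih =>
    rw [cont_add_two P (t + 1), cont_add_two (fun s => P (s + 1)) t]
    rw [show t + 1 + 1 = t + 2 by ring]
    linear_combination ih

lemma IsSol.shift {P Z : ℕ → ℝ} (h : IsSol P Z) {p : ℕ} (hp : ∀ t, P (t + p) = P t) :
    IsSol P (fun t => Z (t + p)) := by
  intro t
  have := h (t + p)
  rw [show t + p + 2 = t + 2 + p by ring, show t + p + 1 = t + 1 + p by ring, hp] at this
  exact this

lemma IsSol.eq_zero {P Z : ℕ → ℝ} (h : IsSol P Z) (h0 : Z 0 = 0) (h1 : Z 1 = 0) (t : ℕ) :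
    Z t = 0 := by
  cases t with
  | zero => exact h0
  | succ t => rw [h.eq_cont, h0, h1]; ring

section Periodic

variable {P : ℕ → ℝ} {p : ℕ}

/-- This is Cayley–Hamilton for the transfer matrix over one period. The difference of the two sides
is itself a solution, so only times 0 and 1 have to be checked. -/
lemma cont_add_two_mul_period (hp1 : 1 ≤ p) (hp : ∀ t, P (t + p) = P t) (t : ℕ) :
    cont P (t + p + p) = tau P p * cont P (t + p) - cont P t := by
  have hZ := (isSol_cont P).shift hp
  have hZZ := hZ.shift hp
  have hS : IsSol P (fun t => cont P (t + p + p) - (tau P p * cont P (t + p) - cont P t)) := by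
    intro t
    have h1 := hZ t
    have h2 := hZZ t
    have h3 := cont_add_two P t
    simp only at h1 h2 ⊢
    rw [h1, h2, h3]
    ring
  obtain ⟨r, rfl⟩ := Nat.exists_eq_add_of_le' hp1
  have hd := cont_det P r
  refine sub_eq_zero.mp (hS.eq_zero ?_ ?_ t)
  · have := hZ.eq_cont r
    simp only [zero_add, add_comm 1 (r + 1)] at this ⊢
    rw [this, tau]
    simp
    ring
  · have := hZ.eq_cont (r + 1)
    simp only [zero_add, add_comm 1 (r + 1), add_assoc (r + 1) 1 (r + 1)] at this ⊢
    rw [this, tau, show r + 1 + 1 = r + 2 by ring, Nat.add_sub_cancel]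
    simp
    linear_combination hd

lemma isSol_period (hp1 : 1 ≤ p) (hp : ∀ t, P (t + p) = P t) (j : ℕ) :
    IsSol (fun _ => tau P p) (fun i => cont P (j + i * p)) := by
  intro i
  have := cont_add_two_mul_period hp1 hp (j + i * p)
  simp only
  rw [show j + (i + 2) * p = j + i * p + p + p by ring,
    show j + (i + 1) * p = j + i * p + p by ring, this]

lemma cont_add_mul_period (hp1 : 1 ≤ p) (hp : ∀ t, P (t + p) = P t) (j m : ℕ) :
    cont P (j + (m + 1) * p) =
      cont P (j + p) * cheb (tau P p) (m + 1) - cont P j * cheb (tau P p) m := by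
  have := (isSol_period hp1 hp j).eq_cont m
  simpa [cheb] using this

lemma cont_period_of_zero (hp : ∀ t, P (t + p) = P t) (h0 : cont P p = 0) (t : ℕ) :
    cont P (t + p) = cont P (p + 1) * cont P t := by
  cases t with
  | zero => simp [h0]
  | succ t =>
    have := ((isSol_cont P).shift hp).eq_cont t
    simp only [zero_add, h0, zero_mul, sub_zero, add_comm 1 p] at this
    exact this

lemma cont_mul_period_of_zero (hp : ∀ t, P (t + p) = P t) (h0 : cont P p = 0) (j m : ℕ) :
    cont P (j + m * p) = cont P (p + 1) ^ m * cont P j := by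
  induction m with
  | zero => simp
  | succ m ih =>
    rw [show j + (m + 1) * p = j + m * p + p by ring, cont_period_of_zero hp h0, ih]
    ring

/-- When Q_p = 0 the transfer matrix is triangular with eigenvalues e = Q_{p+1} and 1/e, and e + 1/e
≥ 2 for e > 0. -/
lemma cont_succ_pos_of_zero (hp1 : 1 ≤ p) (h0 : cont P p = 0) (h1 : 0 ≤ cont P (p + 1)) :
    0 < cont P (p + 1) ∧ 2 ≤ tau P p := by
  obtain ⟨r, rfl⟩ := Nat.exists_eq_add_of_le' hp1
  have hd := cont_det P r
  rw [h0] at hd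
  have hpos : 0 < cont P (r + 2) := by
    refine lt_of_le_of_ne h1 fun h => ?_
    rw [← h] at hd
    linarith
  refine ⟨hpos, ?_⟩
  rw [tau, Nat.add_sub_cancel]
  change 2 ≤ cont P (r + 2) - _
  have h2 : cont P (r + 2) * (cont P (r + 2) - cont (fun s => P (s + 1)) r - 2) =
    (cont P (r + 2) - 1) ^ 2 := by linear_combination -hd
  have h3 : 0 ≤ cont P (r + 2) - cont (fun s => P (s + 1)) r - 2 :=
    nonneg_of_mul_nonneg_right (by rw [h2]; positivity) hpos
  linarith

end Periodic

/-! ### Zeros along a path of parameters -/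

/-- The last sign change of a continuous function. -/
lemma exists_last_zero {f : ℝ → ℝ} (hf : Continuous f) {x y : ℝ} (hxy : x ≤ y) (hx : f x ≤ 0)
    (hy : 0 < f y) : ∃ z, x ≤ z ∧ z ≤ y ∧ f z = 0 ∧ ∀ t, z ≤ t → t ≤ y → 0 ≤ f t := by
  have hK : IsCompact (Set.Icc x y ∩ {t | f t ≤ 0}) :=
    isCompact_Icc.inter_right (isClosed_le hf continuous_const)
  obtain ⟨z, ⟨⟨hz1, hz2⟩, hz3⟩, hz4⟩ := hK.exists_isGreatest ⟨x, ⟨le_rfl, hxy⟩, hx⟩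
  have hz0 : f z = 0 := by
    obtain ⟨t, ⟨ht1, ht2⟩, ht3⟩ := intermediate_value_Icc hz2 hf.continuousOn ⟨hz3, hy.le⟩
    have : t ≤ z := hz4 ⟨⟨by linarith, ht2⟩, ht3.le⟩
    rw [le_antisymm ht1 this, ht3]
  refine ⟨z, hz1, hz2, hz0, fun t ht1 ht2 => ?_⟩
  by_contra! h
  have : t ≤ z := hz4 ⟨⟨by linarith, ht2⟩, h.le⟩
  rw [le_antisymm this ht1, hz0] at h
  exact lt_irrefl _ h

/-- Successive solutions of `c₁ S_{m+1}(τ) = c₀ S_m(τ)` before the trace leaves the range where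
`S₁, …, S_{m+1}` are positive. -/
lemma exists_cheb_zero {τ c₁ : ℝ → ℝ} {c₀ : ℝ} (hτ : Continuous τ) (hc₁ : Continuous c₁)
    (hc₀ : 0 < c₀) {x₀ x₁ : ℝ} (hx : x₀ ≤ x₁) (h0 : c₁ x₀ ≤ 0) (h1 : 2 ≤ τ x₁)
    (hpos : ∀ m, 0 < c₁ x₁ * cheb (τ x₁) (m + 1) - c₀ * cheb (τ x₁) m) (m : ℕ) :
    ∃ x, x₀ ≤ x ∧ x ≤ x₁ ∧ c₁ x * cheb (τ x) (m + 1) - c₀ * cheb (τ x) m = 0 ∧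
      ∀ y, x ≤ y → y ≤ x₁ → ∀ j, 1 ≤ j → j ≤ m + 1 → 0 < cheb (τ y) j := by
  have hcont : ∀ n, Continuous fun x => cheb (τ x) n := fun n => (continuous_cheb n).comp hτ
  induction m with
  | zero =>
    have := hpos 0
    simp only [zero_add, cheb_one, cheb_zero, mul_one, mul_zero, sub_zero] at this ⊢
    obtain ⟨z, hz1, hz2, hz3, -⟩ := exists_last_zero hc₁ hx h0 this
    refine ⟨z, hz1, hz2, hz3, fun y _ _ j hj1 hj2 => ?_⟩
    obtain rfl : j = 1 := by omega
    simp
  | succ m ih =>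
    obtain ⟨x, hx1, hx2, hx3, hx4⟩ := ih
    have hS := hx4 x le_rfl hx2 (m + 1) (by omega) le_rfl
    -- At a zero of level m the Cassini identity makes the function of level m + 1 equal to -c₀ /
    -- S_{m+1}(τ), so its own last zero lies further to the right.
    have hneg : c₁ x * cheb (τ x) (m + 1 + 1) - c₀ * cheb (τ x) (m + 1) ≤ 0 := by
      have hC := cheb_cassini (τ x) m
      have : (c₁ x * cheb (τ x) (m + 2) - c₀ * cheb (τ x) (m + 1)) * cheb (τ x) (m + 1) = -c₀ := by
        linear_combination cheb (τ x) (m + 2) * hx3 - c₀ * hC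
      by_contra! h
      have := mul_pos h hS
      rw [show m + 1 + 1 = m + 2 by ring] at *
      linarith
    have hf : Continuous fun x => c₁ x * cheb (τ x) (m + 1 + 1) - c₀ * cheb (τ x) (m + 1) :=
      (hc₁.mul (hcont _)).sub (continuous_const.mul (hcont _))
    obtain ⟨z, hz1, hz2, hz3, hz4⟩ := exists_last_zero hf hx2 hneg (hpos (m + 1))
    refine ⟨z, by linarith, hz2, hz3, fun y hy1 hy2 j hj1 hj2 => ?_⟩
    rcases hj2.lt_or_eq with hj2 | rfl
    · exact hx4 y (by linarith) hy2 j hj1 (by omega)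
    by_contra! h
    -- A zero of S_{m+2}(τ) to the right of z would make the function -c₀ S_{m+1}(τ) < 0 there, but
    -- it is nonnegative after its last zero.
    obtain ⟨t, ⟨ht1, ht2⟩, ht3⟩ := intermediate_value_Icc hy2 (hcont (m + 1 + 1)).continuousOn
      ⟨h, (cheb_pos_of_two_le h1 hj1).le⟩
    simp only at ht3
    have h5 := hz4 t (by linarith) ht2
    have h6 := hx4 t (by linarith) ht2 (m + 1) (by omega) le_rfl
    rw [ht3] at h5
    nlinarith

/-! ### Palindromic periodic letters -/

/-- The parameter values along the letters `L`. -/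
def along (c : ℝ × ℝ) (L : ℕ → Letter) (t : ℕ) : ℝ := param c (L t)

lemma along_periodic {L : ℕ → Letter} {p : ℕ} (hL : ∀ t, L (t + p) = L t) (c : ℝ × ℝ) (t : ℕ) :
    along c L (t + p) = along c L t := by
  simp [along, hL]

lemma continuous_along {Y : Type*} [TopologicalSpace Y] {c : Y → ℝ × ℝ} (hc : Continuous c)
    (L : ℕ → Letter) (n : ℕ) : Continuous fun y => cont (along (c y) L) n :=
  continuous_cont (P := fun y => along (c y) L) (fun t => (continuous_param (L t)).comp hc) n

lemma continuous_tau_along {Y : Type*} [TopologicalSpace Y] {c : Y → ℝ × ℝ} (hc : Continuous c)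
    (L : ℕ → Letter) (p : ℕ) : Continuous fun y => tau (along (c y) L) p :=
  (continuous_along hc L (p + 1)).sub (continuous_along hc (fun s => L (s + 1)) (p - 1))

/-- The letters `L` have period `p` and are palindromic of length `q + m p`. -/
structure PalindromicLetters (L : ℕ → Letter) (p q m : ℕ) : Prop where
  one_le_m : 1 ≤ m
  one_le_q : 1 ≤ q
  q_lt : q < p
  periodic : ∀ t, L (t + p) = L t
  reverse : ∀ t ≤ q + m * p, L (q + m * p - t) = L t

namespace PalindromicLetters

variable {L : ℕ → Letter} {p q m : ℕ}

lemma cont_reverse_eq (h : PalindromicLetters L p q m) {c : ℝ × ℝ}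
    (h0 : cont (along c L) (q + m * p) = 0) (h1 : 0 ≤ cont (along c L) (q + m * p - 1)) {t : ℕ}
    (ht : t ≤ q + m * p) : cont (along c L) (q + m * p - t) = cont (along c L) t :=
  CriticalCurves.cont_reverse_eq (by have := h.one_le_q; omega)
    (fun t _ ht => by simp only [along, h.reverse t ht.le]) h0 h1 ht

/-- Signs over one period determine the signs over the whole palindrome. -/
lemma signs (h : PalindromicLetters L p q m) {c : ℝ × ℝ}
    (hs : ∀ j < p, 0 ≤ sgn (L j) * cont (along c L) j)
    (hτ : ∀ j, 1 ≤ j → j ≤ m → 0 < cheb (tau (along c L) p) j)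
    (h0 : cont (along c L) (q + m * p) = 0) (h1 : 0 ≤ cont (along c L) (q + m * p - 1)) :
    ∀ t ≤ q + m * p, 0 ≤ sgn (L t) * cont (along c L) t := by
  intro t ht
  have hp1 : 1 ≤ p := by have := h.q_lt; omega
  have hper : ∀ j i, L (j + i * p) = L j := by
    intro j i
    induction i with
    | zero => simp
    | succ i ih => rw [show j + (i + 1) * p = j + i * p + p by ring, h.periodic, ih]
  obtain ⟨i, j, hj, rfl⟩ : ∃ i j, j < p ∧ t = j + i * p :=
    ⟨t / p, t % p, Nat.mod_lt _ hp1, (Nat.mod_add_div' t p).symm⟩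
  rw [hper]
  have hsol : IsSol (fun _ => tau (along c L) p)
      (fun i => sgn (L j) * cont (along c L) (j + i * p)) := by
    intro i
    have := isSol_period hp1 (along_periodic h.periodic c) j i
    simp only at this ⊢
    rw [this]
    ring
  have hstart : 0 ≤ sgn (L j) * cont (along c L) (j + 0 * p) := by simpa using hs j hj
  rcases Nat.lt_or_ge q j with hqj | hqj
  -- For j > q the last index is i = m - 1, with mirror image p + q - j. For j ≤ q it is i = m, with
  -- mirror image q - j.
  · obtain ⟨k, hk⟩ := Nat.exists_eq_add_of_le' h.one_le_m
    have hm : m * p = k * p + p := by rw [hk]; ring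
    have him : i ≤ k := by
      by_contra! hlt
      have : m * p ≤ i * p := Nat.mul_le_mul_right p (by omega)
      omega
    have hsub : q + m * p - (j + k * p) = p + q - j := by omega
    refine interpolation_nonneg hsol (m := k) (fun j hj1 hj2 => hτ j hj1 (by omega)) hstart ?_ him
    rw [← h.cont_reverse_eq h0 h1 (show j + k * p ≤ q + m * p by omega), ← hper j k,
      ← h.reverse (j + k * p) (by omega), hsub]
    exact hs _ (by omega)
  · have him : i ≤ m := by
      by_contra! hlt
      have : (m + 1) * p ≤ i * p := Nat.mul_le_mul_right p (by omega)
      have hm : (m + 1) * p = m * p + p := by ring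
      have := h.q_lt
      omega
    have hsub : q + m * p - (j + m * p) = q - j := by omega
    refine interpolation_nonneg hsol hτ hstart ?_ him
    rw [← h.cont_reverse_eq h0 h1 (show j + m * p ≤ q + m * p by omega), ← hper j m,
      ← h.reverse (j + m * p) (by omega), hsub]
    exact hs _ (by have := h.q_lt; omega)

/-- Reversal at t = q gives Q_{mp} = Q_{n-1} Q_q with n = q + mp, while periodicity gives Q_{mp} =
Q_p S_m(τ). So Q_{n-1} has the sign of Q_p Q_q S_m(τ). -/
lemma last_nonneg (h : PalindromicLetters L p q m) {c : ℝ × ℝ}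
    (hτ : ∀ j, 1 ≤ j → j ≤ m → 0 < cheb (tau (along c L) p) j)
    (h0 : cont (along c L) (q + m * p) = 0) (hq : cont (along c L) q ≠ 0)
    (hpq : 0 ≤ cont (along c L) p * cont (along c L) q) :
    0 ≤ cont (along c L) (q + m * p - 1) := by
  have hp1 : 1 ≤ p := by have := h.q_lt; omega
  have e := cont_reverse (P := along c L) (n := q + m * p) (by have := h.one_le_q; omega)
    (fun t _ ht => by simp only [along, h.reverse t ht.le]) h0 (t := q) (by omega)
  rw [Nat.add_sub_cancel_left] at e
  obtain ⟨k, hk⟩ := Nat.exists_eq_add_of_le' h.one_le_m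
  have e2 := cont_add_mul_period hp1 (along_periodic h.periodic c) 0 k
  simp only [zero_add, cont_zero, zero_mul, sub_zero] at e2
  rw [← hk, e] at e2
  have h3 := (hτ m h.one_le_m le_rfl).le
  have h4 : 0 < cont (along c L) q ^ 2 := by positivity
  have h5 : 0 ≤ cont (along c L) (q + m * p - 1) * cont (along c L) q ^ 2 := by
    have : cont (along c L) (q + m * p - 1) * cont (along c L) q ^ 2 =
      cont (along c L) p * cont (along c L) q * cheb (tau (along c L) p) m := by
      linear_combination cont (along c L) q * e2
    rw [this]
    exact mul_nonneg hpq h3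
  exact nonneg_of_mul_nonneg_left h5 h4

/-- Along a path that ends at a fixed boundary ray the continuant vanishes before the first sign
change of the Chebyshev values of the trace. -/
lemma exists_zero (h : PalindromicLetters L p q m) {c : ℝ → ℝ × ℝ} (hc : Continuous c)
    {C x₀ x₁ : ℝ} (hx : x₀ ≤ x₁) (hC : C ≠ 0) (hq : ∀ x, cont (along (c x) L) q = C)
    (h0 : C * cont (along (c x₀) L) (q + p) ≤ 0) (h1 : cont (along (c x₁) L) p = 0)
    (h2 : 0 ≤ cont (along (c x₁) L) (p + 1)) :
    ∃ x, x₀ ≤ x ∧ x ≤ x₁ ∧ cont (along (c x) L) (q + m * p) = 0 ∧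
      ∀ j, 1 ≤ j → j ≤ m → 0 < cheb (tau (along (c x) L) p) j := by
  have hp1 : 1 ≤ p := by have := h.q_lt; omega
  have hper := fun x => along_periodic h.periodic (c x)
  obtain ⟨k, hk⟩ := Nat.exists_eq_add_of_le' h.one_le_m
  have key : ∀ x n, C * cont (along (c x) L) (q + p) * cheb (tau (along (c x) L) p) (n + 1) -
      C ^ 2 * cheb (tau (along (c x) L) p) n = C * cont (along (c x) L) (q + (n + 1) * p) := by
    intro x n
    rw [cont_add_mul_period hp1 (hper x), hq]
    ring
  obtain ⟨he, ht⟩ := cont_succ_pos_of_zero hp1 h1 h2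
  -- Multiplying by C makes the constant C² positive whatever the sign of Q_q, so one statement
  -- serves both kinds of pencil.
  obtain ⟨x, hx1, hx2, hx3, hx4⟩ := exists_cheb_zero (τ := fun x => tau (along (c x) L) p)
    (c₁ := fun x => C * cont (along (c x) L) (q + p)) (c₀ := C ^ 2)
    (continuous_tau_along hc L p) (continuous_const.mul (continuous_along hc L (q + p)))
    (by positivity) hx h0 ht (fun n => by
      rw [key, cont_mul_period_of_zero (hper x₁) h1, hq]
      have := pow_pos he (n + 1)
      have : 0 < cont (along (c x₁) L) (p + 1) ^ (n + 1) * C ^ 2 := by positivity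
      linarith) k
  refine ⟨x, hx1, hx2, ?_, ?_⟩
  · rw [key, ← hk] at hx3
    exact (mul_eq_zero.mp hx3).resolve_left hC
  · rw [hk]
    exact hx4 x le_rfl hx2

end PalindromicLetters

/-! ### Signs over the first two blocks -/

/-- The letters `L` begin (from time `1`) with `κ` letters `a` and `ℓ` letters `b`. -/
structure TwoBlocks (L : ℕ → Letter) (κ ℓ : ℕ) : Prop where
  block_a : ∀ t, 1 ≤ t → t ≤ κ → L t = Letter.a
  block_b : ∀ t, κ < t → t ≤ κ + ℓ → L t = Letter.b

namespace TwoBlocks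

variable {L : ℕ → Letter} {κ ℓ : ℕ}

lemma cont_left (h : TwoBlocks L κ ℓ) (c : ℝ × ℝ) {t : ℕ} (ht : t ≤ κ + 1) :
    cont (along c L) t = cheb c.1 t :=
  cont_eq_cheb (n := κ + 1)
    (fun s h1 h2 => by simp only [along, h.block_a s h1 (by omega), param]) ht

lemma cont_right (h : TwoBlocks L κ ℓ) (c : ℝ × ℝ) {j : ℕ} (hj : j ≤ ℓ) :
    cont (along c L) (κ + j + 1) =
      cheb c.1 (κ + 1) * cheb c.2 (j + 1) - cheb c.1 κ * cheb c.2 j := by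
  rw [(isSol_cont (along c L)).block (x := c.2) κ (fun i h1 h2 => by
    simp only [along, h.block_b (κ + i) (by omega) (by omega), param]),
    h.cont_left c le_rfl, h.cont_left c (by omega)]

lemma shift (h : TwoBlocks L (κ + 1) ℓ) : TwoBlocks (fun t => L (t + 1)) κ ℓ :=
  ⟨fun t h1 h2 => h.block_a (t + 1) (by omega) (by omega),
    fun t h1 h2 => h.block_b (t + 1) (by omega) (by omega)⟩

lemma range_of_signs (h : TwoBlocks L κ ℓ) (hκ : 2 ≤ κ) (hℓ : 1 ≤ ℓ) {n : ℕ} (hn : κ + 1 < n)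
    {c : ℝ × ℝ} (hs : ∀ t < n, 0 ≤ sgn (L t) * cont (along c L) t) :
    zeta κ ≤ c.1 ∧ c.1 ≤ zeta (κ + 1) := by
  constructor
  · refine zeta_le_of_cheb_nonneg hκ fun j hj => ?_
    rcases Nat.eq_zero_or_pos j with rfl | hj0
    · simp
    have := hs j (by omega)
    rwa [h.block_a j hj0 hj, sgn_a, one_mul, h.cont_left c (by omega)] at this
  · refine le_zeta_of_cheb_nonpos (by omega) ?_
    have := hs (κ + 1) hn
    rw [h.block_b (κ + 1) (by omega) (by omega), sgn_b, h.cont_left c le_rfl] at this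
    linarith

lemma cheb_ne_zero_of_succ {x : ℝ} {n : ℕ} (h : cheb x (n + 1) = 0) : cheb x n ≠ 0 := by
  intro h0
  have := cheb_cassini x n
  rw [h, h0] at this
  norm_num at this

/-- Sturm comparison at t = 1, where both continuants are 1, gives equal first parameters. For the
second it is applied at the first b, time κ + 1, or at κ + 2 if Q_{κ+1} = 0, since two consecutive
continuants cannot both vanish. -/
lemma antichain (h : TwoBlocks L κ ℓ) (hκ : 1 ≤ κ) (hℓ : 2 ≤ ℓ) {n : ℕ} (hn : κ + 2 < n)
    {c c' : ℝ × ℝ} (hs : ∀ t < n, 0 ≤ sgn (L t) * cont (along c L) t)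
    (hs' : ∀ t < n, 0 ≤ sgn (L t) * cont (along c' L) t)
    (h0 : cont (along c L) n = 0) (h0' : cont (along c' L) n = 0)
    (h1 : c.1 ≤ c'.1) (h2 : c.2 ≤ c'.2) : c = c' := by
  have hpq : ∀ t, along c L t ≤ along c' L t := by
    intro t
    unfold along
    cases L t
    · exact h1
    · exact h2
  have hsq : ∀ t, sgn (L t) ^ 2 = 1 := by
    intro t
    cases L t <;> simp
  have key := fun t => sturm (t := t) hpq hsq hs hs' h0 h0'
  have e1 : c.1 = c'.1 := by
    have := key 1 le_rfl (by omega)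
    simp only [cont_one, along, h.block_a 1 le_rfl hκ, param] at this
    linarith
  refine Prod.ext e1 ?_
  rcases eq_or_ne (cheb c.1 (κ + 1)) 0 with h3 | h3
  · have h4 := cheb_ne_zero_of_succ h3
    have := key (κ + 2) (by omega) hn
    have e2 := h.cont_right c (j := 1) (by omega)
    have e3 := h.cont_right c' (j := 1) (by omega)
    rw [← e1] at e3
    rw [h3] at e2 e3
    simp only [cheb_one, zero_mul, zero_sub, mul_one] at e2 e3
    rw [show κ + 2 = κ + 1 + 1 by ring, e2, e3] at this
    simp only [along, h.block_b (κ + 1 + 1) (by omega) (by omega), param] at this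
    have h5 := (mul_eq_zero.mp this).resolve_left (by simpa using h4)
    linarith
  · have := key (κ + 1) (by omega) (by omega)
    rw [h.cont_left c le_rfl, h.cont_left c' le_rfl, ← e1] at this
    simp only [along, h.block_b (κ + 1) (by omega) (by omega), param] at this
    have h5 := (mul_eq_zero.mp this).resolve_left (by simpa using h3)
    linarith

/-- The signs over the first two blocks. -/
lemma first_signs (h : TwoBlocks L κ ℓ) (hκ : 2 ≤ κ) (hℓ : 3 ≤ ℓ) {c : ℝ × ℝ}
    (h1 : zeta κ ≤ c.1) (h2 : c.1 ≤ zeta (κ + 1)) (h3 : zeta (ℓ - 1) ≤ c.2)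
    (h4 : cont (along c L) (κ + ℓ) ≤ 0) :
    ∀ j ≤ κ + ℓ, 0 ≤ sgn (L j) * cont (along c L) j := by
  intro j hj
  rcases Nat.eq_zero_or_pos j with rfl | hj0
  · simp
  rcases Nat.lt_or_ge κ j with hκj | hκj
  · rw [h.block_b j hκj hj, sgn_b]
    obtain ⟨i, rfl⟩ := Nat.exists_eq_add_of_le hκj
    -- The lower bound ζ_{ℓ-1} controls S_i(b) only for i ≤ ℓ - 1, so the last index needs the
    -- separate hypothesis.
    rcases hj.eq_or_lt with e | hlt
    · rw [e]
      linarith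
    rw [show κ.succ + i = κ + i + 1 by omega, h.cont_right c (by omega)]
    have a1 := cheb_nonneg hκ h1 (i := κ) le_rfl
    have a2 := cheb_nonpos hκ (by omega) (by omega) h1 h2
    have b1 := cheb_nonneg (by omega) h3 (i := i + 1) (by omega)
    have b2 := cheb_nonneg (by omega) h3 (i := i) (by omega)
    nlinarith [mul_nonneg a1 b2, mul_nonneg (neg_nonneg.mpr a2) b1]
  · rw [h.block_a j hj0 hκj, sgn_a, one_mul, h.cont_left c (by omega)]
    exact cheb_nonneg hκ h1 hκj

end TwoBlocks

lemma neg_cheb_window {κ : ℕ} (hκ : 2 ≤ κ) {x : ℝ} (h1 : zeta κ < x) (h2 : x < zeta (κ + 1)) :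
    0 < cheb x κ ∧ cheb x (κ + 1) < 0 :=
  ⟨cheb_pos (by omega) h1, cheb_neg hκ (by omega) (by omega) h1 h2⟩

/-- The range of `b` for which the second block consists of `ℓ` letters. -/
lemma exists_window {κ ℓ : ℕ} (hκ : 2 ≤ κ) (hℓ : 3 ≤ ℓ) {x : ℝ} (h1 : zeta κ < x)
    (h2 : x < zeta (κ + 1)) :
    ∃ b₀ b₁, zeta (ℓ - 1) ≤ b₀ ∧ b₀ ≤ b₁ ∧
      cheb x (κ + 1) * cheb b₀ ℓ - cheb x κ * cheb b₀ (ℓ - 1) = 0 ∧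
      cheb x (κ + 1) * cheb b₁ (ℓ + 1) - cheb x κ * cheb b₁ ℓ = 0 ∧
      ∀ b, b₀ ≤ b → b ≤ b₁ →
        cheb x (κ + 1) * cheb b ℓ - cheb x κ * cheb b (ℓ - 1) ≤ 0 ∧
        0 ≤ cheb x (κ + 1) * cheb b (ℓ + 1) - cheb x κ * cheb b ℓ := by
  obtain ⟨hr, hq⟩ := neg_cheb_window hκ h1 h2
  obtain ⟨l, rfl⟩ := Nat.exists_eq_add_of_le' (show 1 ≤ ℓ by omega)
  rw [Nat.add_sub_cancel]
  have hl : 2 ≤ l := by omega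
  have z1 := (zeta_lt_zeta (show 1 ≤ l by omega) (show l < l + 1 by omega)).le
  have z2 := (zeta_lt_zeta (show 1 ≤ l + 1 by omega) (show l + 1 < l + 1 + 1 by omega)).le
  obtain ⟨b₀, hb1, hb2, hb3, hb4⟩ := exists_last_zero
    (f := fun b => -(cheb x (κ + 1) * cheb b (l + 1) - cheb x κ * cheb b l))
    (((continuous_const.mul (continuous_cheb _)).sub
      (continuous_const.mul (continuous_cheb _))).neg) z1
    (by rw [cheb_zeta_self hl, cheb_zeta_succ hl]; linarith)
    (by
      have := cheb_zeta_pred (show 2 ≤ l + 1 by omega)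
      rw [Nat.add_sub_cancel] at this
      rw [cheb_zeta_self (by omega), this]
      linarith)
  -- Reflecting the variable turns the last zero into the first zero beyond ζ_ℓ. Thus b₀ lies in
  -- [ζ_{ℓ-1}, ζ_ℓ] and b₁ in [ζ_ℓ, ζ_{ℓ+1}].
  obtain ⟨b₁, hd1, hd2, hd3, hd4⟩ := exists_last_zero
    (f := fun b => cheb x (κ + 1) * cheb (-b) (l + 1 + 1) - cheb x κ * cheb (-b) (l + 1))
    ((continuous_const.mul ((continuous_cheb _).comp continuous_neg)).sub
      (continuous_const.mul ((continuous_cheb _).comp continuous_neg)))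
    (neg_le_neg z2)
    (by
      have := cheb_zeta_pred (show 2 ≤ l + 1 + 1 by omega)
      rw [Nat.add_sub_cancel] at this
      rw [neg_neg, cheb_zeta_self (by omega), this]
      linarith)
    (by rw [neg_neg, cheb_zeta_self (by omega), cheb_zeta_succ (by omega)]; linarith)
  refine ⟨b₀, -b₁, hb1, by linarith, by linarith, by linarith, fun b h3 h4 => ?_⟩
  rcases le_total b (zeta (l + 1)) with h5 | h5
  · have s1 := cheb_nonpos (j := l + 1) hl (by omega) (by omega) (by linarith) h5
    have s2 := cheb_nonpos (j := l + 1 + 1) hl (by omega) (by omega) (by linarith)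
      (h5.trans z2)
    have := hb4 b h3 h5
    refine ⟨by linarith, ?_⟩
    nlinarith [mul_nonneg (neg_nonneg.mpr hq.le) (neg_nonneg.mpr s2),
      mul_nonneg hr.le (neg_nonneg.mpr s1)]
  · have s1 := cheb_nonneg (by omega) h5 (i := l + 1) le_rfl
    have s2 := cheb_nonneg (by omega) h5 (i := l) (by omega)
    have := hd4 (-b) (by linarith) (by linarith)
    rw [neg_neg] at this
    refine ⟨?_, this⟩
    nlinarith [mul_nonneg (neg_nonneg.mpr hq.le) s1, mul_nonneg hr.le s2]

/-! ### The curves of rank two -/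

/-- The letters of `a^{κ+1} b^ℓ`. -/
def stepLetter (κ t : ℕ) : Letter := if t ≤ κ then Letter.a else Letter.b

lemma twoBlocks_stepLetter (κ ℓ : ℕ) : TwoBlocks (stepLetter κ) κ ℓ :=
  ⟨fun t _ h => by simp [stepLetter, h], fun t h _ => by simp [stepLetter, h]⟩

lemma length_wa_wb (i j : ℕ) : (wa i ++ wb j).length = i + j := by simp [wa, wb]

lemma getElem_wa_wb (κ ℓ t : ℕ) (ht : t < (wa (κ + 1) ++ wb ℓ).length) (_ : 1 ≤ t) :
    (wa (κ + 1) ++ wb ℓ)[t] = stepLetter κ t := by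
  unfold stepLetter
  split_ifs with h
  · rw [List.getElem_append_left (by simp [wa]; omega)]
    simp [wa]
  · rw [List.getElem_append_right (by simp [wa]; omega)]
    simp [wb]

lemma aeval_curvePoly_wa_wb {κ ℓ : ℕ} (hℓ : 1 ≤ ℓ) (c : ℝ × ℝ) :
    MvPolynomial.aeval (param c) (curvePoly (wa (κ + 1) ++ wb ℓ)) =
      cheb c.1 (κ + 1) * cheb c.2 (ℓ + 1) - cheb c.1 κ * cheb c.2 ℓ := by
  obtain ⟨j, rfl⟩ := Nat.exists_eq_add_of_le' hℓ
  unfold curvePoly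
  rw [rank_wa_wb, if_neg (by decide), aeval_Q (getElem_wa_wb κ (j + 1)) c le_rfl, length_wa_wb,
    show κ + 1 + (j + 1) = κ + (j + 1) + 1 by ring]
  exact (twoBlocks_stepLetter κ (j + 1)).cont_right c le_rfl

lemma map_flip_wa_wb (i j : ℕ) : (wa i ++ wb j).map flip = wb i ++ wa j := by
  rw [List.map_append, map_flip_wa, map_flip_wb]

lemma aeval_curvePoly_wb_wa {κ ℓ : ℕ} (hκ : 1 ≤ κ) (c : ℝ × ℝ) :
    MvPolynomial.aeval (param c) (curvePoly (wb (ℓ + 1) ++ wa κ)) =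
      cheb c.1 (κ + 1) * cheb c.2 (ℓ + 1) - cheb c.1 κ * cheb c.2 ℓ := by
  have h1 := aeval_curvePoly_wa_wb (κ := ℓ) hκ c.swap
  obtain ⟨j, rfl⟩ := Nat.exists_eq_add_of_le' hκ
  have h2 := aeval_Q_map_flip (w := wa (ℓ + 1) ++ wb (j + 1)) (c := c.swap) le_rfl
  rw [← map_flip_wa_wb]
  unfold curvePoly at h1 ⊢
  rw [rank_wa_wb, if_neg (by decide)] at h1
  rw [rank_map_flip, rank_wa_wb, if_neg (by decide), List.length_map]
  rw [Prod.swap_swap] at h2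
  rw [h2, h1]
  simp only [Prod.fst_swap, Prod.snd_swap]
  ring

/-- Integer polynomials are determined by their values at real parameters. -/
lemma eq_of_aeval_eq {p q : MvPolynomial Letter ℤ}
    (h : ∀ c, MvPolynomial.aeval (param c) p = MvPolynomial.aeval (param c) q) : p = q := by
  apply MvPolynomial.map_injective (Int.castRingHom ℝ) Int.cast_injective
  refine MvPolynomial.funext fun x => ?_
  have hx : x = param (x Letter.a, x Letter.b) := by
    funext l
    cases l <;> rfl
  have := h (x Letter.a, x Letter.b)
  rw [← hx] at this
  rw [MvPolynomial.eval_map, MvPolynomial.eval_map]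
  exact this

/-- The legal points of `a^{κ+1} b^ℓ`. -/
lemma legal_wa_wb_iff {κ ℓ : ℕ} (hκ : 2 ≤ κ) (hℓ : 2 ≤ ℓ) (c : ℝ × ℝ) :
    Legal (wa (κ + 1) ++ wb ℓ) c ↔
      (zeta κ ≤ c.1 ∧ c.1 ≤ zeta (κ + 1)) ∧ (zeta ℓ ≤ c.2 ∧ c.2 ≤ zeta (ℓ + 1)) ∧
        cheb c.1 (κ + 1) * cheb c.2 (ℓ + 1) - cheb c.1 κ * cheb c.2 ℓ = 0 := by
  have hB := twoBlocks_stepLetter κ ℓ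
  have hleg := legal_iff (w := wa (κ + 1) ++ wb ℓ) rfl (getElem_wa_wb κ ℓ) c
  rw [length_wa_wb, show κ + 1 + ℓ = κ + ℓ + 1 by ring] at hleg
  rw [hleg]
  change (cont (along c (stepLetter κ)) _ = 0 ∧
    ∀ t < _, 0 ≤ sgn (stepLetter κ t) * cont (along c (stepLetter κ)) t) ↔ _
  constructor
  · rintro ⟨h0, hs⟩
    have hr := hB.range_of_signs hκ (by omega) (by omega) hs
    -- Running the recurrence backwards from the final zero through the block of b's turns the sign
    -- conditions into conditions on S_j(b), which bound b just as the first block bounds a.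
    have key : ∀ j ≤ ℓ + 1, cont (along c (stepLetter κ)) (κ + ℓ + 1 - j) =
        cont (along c (stepLetter κ)) (κ + ℓ) * cheb c.2 j := by
      intro j
      induction j using Nat.twoStepInduction with
      | zero => intro _; simp [h0]
      | one => intro _; simp
      | more j h1 h2 =>
        intro hj
        have e1 := h1 (by omega)
        have e2 := h2 (by omega)
        have e3 := cont_add_two (along c (stepLetter κ)) (κ + ℓ + 1 - (j + 2))
        rw [show κ + ℓ + 1 - (j + 2) + 2 = κ + ℓ + 1 - j by omega,
          show κ + ℓ + 1 - (j + 2) + 1 = κ + ℓ + 1 - (j + 1) by omega] at e3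
        have e4 : along c (stepLetter κ) (κ + ℓ + 1 - (j + 1)) = c.2 := by
          simp only [along, hB.block_b (κ + ℓ + 1 - (j + 1)) (by omega) (by omega), param]
        rw [e1, e2, e4] at e3
        rw [cheb_add_two]
        linear_combination e3
    have hneg : cont (along c (stepLetter κ)) (κ + ℓ) < 0 := by
      refine lt_of_le_of_ne ?_ fun h => ?_
      · have := hs (κ + ℓ) (by omega)
        rw [hB.block_b (κ + ℓ) (by omega) (by omega), sgn_b] at this
        linarith
      · have k1 := key ℓ (by omega)
        have k2 := key (ℓ + 1) le_rfl
        rw [h, zero_mul] at k1 k2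
        rw [show κ + ℓ + 1 - ℓ = κ + 1 by omega, hB.cont_left c le_rfl] at k1
        rw [show κ + ℓ + 1 - (ℓ + 1) = κ by omega, hB.cont_left c (by omega)] at k2
        exact TwoBlocks.cheb_ne_zero_of_succ k1 k2
    refine ⟨hr, ⟨zeta_le_of_cheb_nonneg hℓ fun j hj => ?_,
      le_zeta_of_cheb_nonpos (by omega) ?_⟩, ?_⟩
    · rcases Nat.eq_zero_or_pos j with rfl | hj0
      · simp
      have k1 := key j (by omega)
      have := hs (κ + ℓ + 1 - j) (by omega)
      rw [hB.block_b _ (by omega) (by omega), sgn_b, k1] at this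
      by_contra! hlt
      nlinarith [mul_pos_of_neg_of_neg hneg hlt]
    · have k1 := key (ℓ + 1) le_rfl
      have := hs κ (by omega)
      rw [hB.block_a _ (by omega) le_rfl, sgn_a] at this
      rw [show κ + ℓ + 1 - (ℓ + 1) = κ by omega] at k1
      rw [k1] at this
      by_contra! hlt
      nlinarith [mul_neg_of_neg_of_pos hneg hlt]
    · rw [← h0, hB.cont_right c le_rfl]
  · rintro ⟨⟨h1, h2⟩, ⟨h3, h4⟩, h5⟩
    refine ⟨by rw [hB.cont_right c le_rfl, h5], fun t ht => ?_⟩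
    rcases Nat.eq_zero_or_pos t with rfl | ht0
    · simp
    rcases Nat.lt_or_ge κ t with hκt | hκt
    · rw [hB.block_b t hκt (by omega), sgn_b]
      obtain ⟨i, rfl⟩ := Nat.exists_eq_add_of_le hκt
      rw [show κ.succ + i = κ + i + 1 by omega, hB.cont_right c (by omega)]
      have a1 := cheb_nonneg hκ h1 (i := κ) le_rfl
      have a2 := cheb_nonpos hκ (by omega) (by omega) h1 h2
      have b1 := cheb_nonneg hℓ h3 (i := i + 1) (by omega)
      have b2 := cheb_nonneg hℓ h3 (i := i) (by omega)
      nlinarith [mul_nonneg a1 b2, mul_nonneg (neg_nonneg.mpr a2) b1]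
    · rw [hB.block_a t ht0 hκt, sgn_a, one_mul, hB.cont_left c (by omega)]
      exact cheb_nonneg hκ h1 hκt

lemma legalArc_wa_wb {κ ℓ : ℕ} (hκ : 2 ≤ κ) (hℓ : 2 ≤ ℓ) :
    legalArc (wa (κ + 1) ++ wb ℓ) = {c | Legal (wa (κ + 1) ++ wb ℓ) c} := by
  ext c
  refine ⟨fun h => h.2, fun h => ⟨?_, h⟩⟩
  simp only [curve, Set.mem_ofPred_eq]
  rw [aeval_curvePoly_wa_wb (by omega)]
  exact ((legal_wa_wb_iff hκ hℓ c).mp h).2.2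

/-- The characterization in `legal_wa_wb_iff` is invariant under exchanging the two parameters
together with κ and ℓ, and the second word is the flipped first word for the exchanged exponents. -/
lemma legalArc_wb_wa {κ ℓ : ℕ} (hκ : 2 ≤ κ) (hℓ : 2 ≤ ℓ) :
    legalArc (wa (κ + 1) ++ wb ℓ) = legalArc (wb (ℓ + 1) ++ wa κ) := by
  rw [← map_flip_wa_wb, legalArc_map_flip (by rw [length_wa_wb]; omega), legalArc_wa_wb hκ hℓ,
    legalArc_wa_wb hℓ hκ]
  ext c
  simp only [Set.mem_preimage, Set.mem_ofPred_eq, legal_wa_wb_iff hκ hℓ, legal_wa_wb_iff hℓ hκ,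
    Prod.fst_swap, Prod.snd_swap, mul_comm (cheb c.2 _)]
  tauto

lemma isArc_wa_wb {κ ℓ : ℕ} (hκ : 2 ≤ κ) (hℓ : 2 ≤ ℓ) :
    IsArcWithEndpoints (legalArc (wa (κ + 1) ++ wb ℓ))
      (doublePoint κ (ℓ + 1)) (doublePoint (κ + 1) ℓ) := by
  rw [legalArc_wa_wb hκ hℓ]
  have zκ := zeta_lt_zeta (show 1 ≤ κ by omega) (show κ < κ + 1 by omega)
  have zℓ := zeta_lt_zeta (show 1 ≤ ℓ by omega) (show ℓ < ℓ + 1 by omega)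
  have hB := twoBlocks_stepLetter κ ℓ
  refine (isArc_of_antichain (isClosed_legal rfl (getElem_wa_wb κ ℓ)) zκ ?_ ?_ ?_ ?_ ?_).1
  · rw [Set.mem_ofPred_eq, legal_wa_wb_iff hκ hℓ]
    refine ⟨⟨le_rfl, zκ.le⟩, ⟨zℓ.le, le_rfl⟩, ?_⟩
    simp [doublePoint, cheb_zeta_self hκ, cheb_zeta_self (show 2 ≤ ℓ + 1 by omega)]
  · rw [Set.mem_ofPred_eq, legal_wa_wb_iff hκ hℓ]
    refine ⟨⟨zκ.le, le_rfl⟩, ⟨le_rfl, zℓ.le⟩, ?_⟩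
    simp [doublePoint, cheb_zeta_self hℓ, cheb_zeta_self (show 2 ≤ κ + 1 by omega)]
  · intro c hc
    rw [Set.mem_ofPred_eq, legal_wa_wb_iff hκ hℓ] at hc
    exact hc.1
  · intro x h1 h2
    change zeta κ < x at h1
    change x < zeta (κ + 1) at h2
    obtain ⟨hr, hq⟩ := neg_cheb_window hκ h1 h2
    have hc : Continuous fun b => cheb x (κ + 1) * cheb b (ℓ + 1) - cheb x κ * cheb b ℓ :=
      (continuous_const.mul (continuous_cheb _)).sub (continuous_const.mul (continuous_cheb _))
    have e1 := cheb_zeta_pred (show 2 ≤ ℓ + 1 by omega)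
    rw [Nat.add_sub_cancel] at e1
    obtain ⟨b, hb, hb0⟩ := intermediate_value_Icc' zℓ.le hc.continuousOn (show (0 : ℝ) ∈ _ by
      constructor
      · rw [cheb_zeta_self (by omega), e1]
        linarith
      · rw [cheb_zeta_self hℓ, cheb_zeta_succ hℓ]
        linarith)
    exact ⟨b, (legal_wa_wb_iff hκ hℓ _).mpr ⟨⟨h1.le, h2.le⟩, hb, hb0⟩⟩
  · intro c h c' h' hle1 hle2
    obtain ⟨h0, hs⟩ := (legal_iff rfl (getElem_wa_wb κ ℓ) c).mp h
    obtain ⟨h0', hs'⟩ := (legal_iff rfl (getElem_wa_wb κ ℓ) c').mp h'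
    rw [length_wa_wb] at h0 h0' hs hs'
    exact hB.antichain (by omega) hℓ (by omega) hs hs' h0 h0' hle1 hle2

/-! ### Words of a pencil -/

/-- A word whose letters from time `1` on are `p`-periodic and palindromic, and begin with `κ`
letters `a` and `ℓ` letters `b`. -/
structure PencilWord (w : Word) (L : ℕ → Letter) (κ ℓ p q m : ℕ) : Prop where
  two_le : 2 ≤ κ
  three_le : 3 ≤ ℓ
  rank_eq : rank w = 2 * m + 1
  start_eq : start w = (0, -1)
  length_eq : w.length = q + m * p
  letters : ∀ t (ht : t < w.length), 1 ≤ t → w[t] = L t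
  blocks : TwoBlocks L κ ℓ
  pal : PalindromicLetters L p q m
  le_q : κ ≤ q
  le_p : κ + ℓ ≤ p
  p_le : p ≤ κ + ℓ + 1

namespace PencilWord

variable {w : Word} {L : ℕ → Letter} {κ ℓ p q m : ℕ}

lemma lt_length (h : PencilWord w L κ ℓ p q m) : κ + ℓ < q + m * p := by
  have h1 := h.pal.one_le_q
  have h2 : 1 * p ≤ m * p := Nat.mul_le_mul_right p h.pal.one_le_m
  have := h.le_p
  omega

lemma legal_iff (h : PencilWord w L κ ℓ p q m) (c : ℝ × ℝ) :
    Legal w c ↔ cont (along c L) (q + m * p) = 0 ∧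
      ∀ t < q + m * p, 0 ≤ sgn (L t) * cont (along c L) t := by
  rw [CriticalCurves.legal_iff h.start_eq h.letters c, h.length_eq]
  rfl

/-- By the palindrome the letter at time n - 1 equals the one at time 1, which is a. Hence Q_{n-1} ≥
0, and reversal puts every legal point on the critical curve. -/
lemma legalArc_eq (h : PencilWord w L κ ℓ p q m) : legalArc w = {c | Legal w c} := by
  ext c
  refine ⟨fun hc => hc.2, fun hc => ⟨?_, hc⟩⟩
  obtain ⟨h0, hs⟩ := (h.legal_iff c).mp hc
  have hlen := h.lt_length
  have hκ := h.two_le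
  have hlast := hs (q + m * p - 1) (by omega)
  rw [h.pal.reverse 1 (by omega), h.blocks.block_a 1 le_rfl (by omega), sgn_a, one_mul] at hlast
  refine mem_curve_of_reverse (by rw [h.rank_eq]; exact ⟨m, rfl⟩) h.letters
    (by rw [h.length_eq]; omega) ?_
  rw [h.length_eq]
  exact fun t ht => h.pal.cont_reverse_eq h0 hlast ht

lemma legal_of_signs (h : PencilWord w L κ ℓ p q m) {c : ℝ × ℝ}
    (h1 : zeta κ ≤ c.1) (h2 : c.1 ≤ zeta (κ + 1)) (h3 : zeta (ℓ - 1) ≤ c.2)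
    (h4 : cont (along c L) (κ + ℓ) ≤ 0)
    (hτ : ∀ j, 1 ≤ j → j ≤ m → 0 < cheb (tau (along c L) p) j)
    (h0 : cont (along c L) (q + m * p) = 0) (h5 : 0 ≤ cont (along c L) (q + m * p - 1)) :
    Legal w c := by
  refine (h.legal_iff c).mpr ⟨h0, fun t ht => h.pal.signs (fun j hj => ?_) hτ h0 h5 t ht.le⟩
  exact h.blocks.first_signs h.two_le h.three_le h1 h2 h3 h4 j (by have := h.p_le; omega)

lemma legal_of_product (h : PencilWord w L κ ℓ p q m) {c : ℝ × ℝ}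
    (h1 : zeta κ ≤ c.1) (h2 : c.1 ≤ zeta (κ + 1)) (h3 : zeta (ℓ - 1) ≤ c.2)
    (h4 : cont (along c L) (κ + ℓ) ≤ 0)
    (hτ : ∀ j, 1 ≤ j → j ≤ m → 0 < cheb (tau (along c L) p) j)
    (h0 : cont (along c L) (q + m * p) = 0) (h5 : cont (along c L) q ≠ 0)
    (h6 : 0 ≤ cont (along c L) p * cont (along c L) q) : Legal w c :=
  h.legal_of_signs h1 h2 h3 h4 hτ h0 (h.pal.last_nonneg hτ h0 h5 h6)

/-- The basis of the pencil is legal. -/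
lemma legal_basis (h : PencilWord w L κ ℓ p q m) {c : ℝ × ℝ}
    (h1 : zeta κ ≤ c.1) (h2 : c.1 ≤ zeta (κ + 1)) (h3 : zeta (ℓ - 1) ≤ c.2)
    (h4 : cont (along c L) (κ + ℓ) ≤ 0) (h5 : cont (along c L) p = 0)
    (h6 : cont (along c L) (p + 1) = 1) (h7 : cont (along c L) q = 0)
    (h8 : 0 ≤ cont (along c L) (q - 1)) : Legal w c := by
  have hper := along_periodic h.pal.periodic c
  obtain ⟨-, ht⟩ := cont_succ_pos_of_zero (by have := h.le_p; have := h.two_le; omega) h5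
    (by rw [h6]; exact zero_le_one)
  refine h.legal_of_signs h1 h2 h3 h4 (fun j hj _ => cheb_pos_of_two_le ht hj) ?_ ?_
  · rw [cont_mul_period_of_zero hper h5, h7, mul_zero]
  · have := h.pal.one_le_q
    rw [show q + m * p - 1 = q - 1 + m * p by omega, cont_mul_period_of_zero hper h5, h6]
    simpa using h8

/-- The legal arc of a word of a pencil, given its end-points and its interior points. -/
lemma isArc (h : PencilWord w L κ ℓ p q m) {y z : ℝ} (hy : Legal w (zeta κ, y))
    (hz : Legal w (zeta (κ + 1), z)) (hz0 : 0 ≤ z)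
    (hex : ∀ x, zeta κ < x → x < zeta (κ + 1) → ∃ b, Legal w (x, b)) :
    legalArc w ⊆ firstQuadrant ∧
      IsArcWithEndpoints (legalArc w) (zeta κ, y) (zeta (κ + 1), z) := by
  have hκ := h.two_le
  have hℓ := h.three_le
  have hlen := h.lt_length
  rw [h.legalArc_eq]
  have hb : ∀ c ∈ {c | Legal w c}, zeta κ ≤ c.1 ∧ c.1 ≤ zeta (κ + 1) := fun c hc =>
    h.blocks.range_of_signs hκ (by omega) (by omega) ((h.legal_iff c).mp hc).2
  obtain ⟨h1, h2⟩ := isArc_of_antichain (p := (zeta κ, y)) (q := (zeta (κ + 1), z))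
    (isClosed_legal h.start_eq h.letters)
    (zeta_lt_zeta (show 1 ≤ κ by omega) (show κ < κ + 1 by omega)) hy hz hb hex
    (fun c hc c' hc' hle1 hle2 => by
      obtain ⟨h0, hs⟩ := (h.legal_iff c).mp hc
      obtain ⟨h0', hs'⟩ := (h.legal_iff c').mp hc'
      exact h.blocks.antichain (by omega) (by omega) (by omega) hs hs' h0 h0' hle1 hle2)
  exact ⟨fun c hc => ⟨(zeta_nonneg hκ).trans (hb c hc).1, hz0.trans (h2 c hc).1⟩, h1⟩

end PencilWord

lemma blockLetter_add_mul (i p s t k : ℕ) :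
    blockLetter i p s (t + k * p) = blockLetter i p s t := by
  unfold blockLetter
  rw [show t + k * p + s = t + s + k * p by ring, Nat.add_mul_mod_self_right]

lemma blockLetter_zero {i p j : ℕ} (hj : j < p) :
    blockLetter i p 0 j = if j < i then Letter.a else Letter.b := by
  unfold blockLetter
  rw [add_zero, Nat.mod_eq_of_lt hj]

lemma blockLetter_pred {i p j : ℕ} (hi : i < p) (hj : j < p) :
    blockLetter i p (p - 1) j = if 1 ≤ j ∧ j ≤ i then Letter.a else Letter.b := by
  unfold blockLetter
  rcases Nat.eq_zero_or_pos j with rfl | hj0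
  · rw [zero_add, Nat.mod_eq_of_lt (by omega), if_neg (by omega), if_neg (by omega)]
  · rw [show j + (p - 1) = j - 1 + p by omega, Nat.add_mod_right, Nat.mod_eq_of_lt (by omega)]
    by_cases h : j ≤ i
    · rw [if_pos (by omega), if_pos (by omega)]
    · rw [if_neg (by omega), if_neg (by omega)]

/-- Palindromicity of a periodic sequence of letters follows from that of the two palindromes
in one period. -/
lemma palindromicLetters_of_reverse {L : ℕ → Letter} {p q m : ℕ} (hm : 1 ≤ m) (hq1 : 1 ≤ q)
    (hq : q < p) (hper : ∀ t k, L (t + k * p) = L t) (h1 : ∀ j ≤ q, L (q - j) = L j)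
    (h2 : ∀ j, q < j → j < p → L (p + q - j) = L j) : PalindromicLetters L p q m := by
  refine ⟨hm, hq1, hq, fun t => by simpa using hper t 1, fun t ht => ?_⟩
  obtain ⟨i, j, hj, rfl⟩ : ∃ i j, j < p ∧ t = j + i * p :=
    ⟨t / p, t % p, Nat.mod_lt _ (by omega), (Nat.mod_add_div' t p).symm⟩
  rw [hper]
  rcases Nat.lt_or_ge q j with hqj | hqj
  · have him : i + 1 ≤ m := by
      by_contra! hlt
      have : m * p ≤ i * p := Nat.mul_le_mul_right p (by omega)
      omega
    obtain ⟨k, rfl⟩ := Nat.exists_eq_add_of_le him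
    have e : q + (i + 1 + k) * p - (j + i * p) = p + q - j + k * p := by
      have : (i + 1 + k) * p = i * p + p + k * p := by ring
      omega
    rw [e, hper, h2 j hqj hj]
  · have him : i ≤ m := by
      by_contra! hlt
      have : (m + 1) * p ≤ i * p := Nat.mul_le_mul_right p (by omega)
      have hm : (m + 1) * p = m * p + p := by ring
      omega
    obtain ⟨k, rfl⟩ := Nat.exists_eq_add_of_le him
    have e : q + (i + k) * p - (j + i * p) = q - j + k * p := by
      have : (i + k) * p = i * p + k * p := by ring
      omega
    rw [e, hper, h1 j hqj]

/-- The palindrome includes time n, one letter beyond the word: it is (a^{κ+1} b^ℓ)^m a^{κ+1}. -/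
lemma pencilWord_minus {κ ℓ m : ℕ} (hκ : 2 ≤ κ) (hℓ : 2 < ℓ) (hm : 1 ≤ m) :
    PencilWord (wpow (wa (κ + 1) ++ wb ℓ) m ++ wa κ) (blockLetter (κ + 1) (κ + ℓ + 1) 0)
      κ ℓ (κ + ℓ + 1) κ m := by
  have hL : ∀ j, j < κ + ℓ + 1 → blockLetter (κ + 1) (κ + ℓ + 1) 0 j =
      if j < κ + 1 then Letter.a else Letter.b := fun j hj => blockLetter_zero hj
  obtain ⟨k, rfl⟩ := Nat.exists_eq_add_of_le' (show 1 ≤ κ by omega)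
  obtain ⟨l, rfl⟩ := Nat.exists_eq_add_of_le' (show 1 ≤ ℓ by omega)
  refine ⟨hκ, hℓ, rank_periodic _ _ _ _, ?_, ?_, ?_, ⟨?_, ?_⟩,
    palindromicLetters_of_reverse hm (by omega) (by omega) (blockLetter_add_mul _ _ _) ?_ ?_,
    le_rfl, by omega, by omega⟩
  · obtain ⟨n, rfl⟩ := Nat.exists_eq_add_of_le' hm
    rw [wpow_succ, wa_succ]
    rfl
  · rw [length_periodic]
    ring
  · intro t ht _
    rw [getElem_periodic (by omega), show k + 1 + 1 + (l + 1) = k + 1 + (l + 1) + 1 by ring]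
  · intro t h1 h2
    rw [hL t (by omega), if_pos (by omega)]
  · intro t h1 h2
    rw [hL t (by omega), if_neg (by omega)]
  · intro j hj
    rw [hL _ (by omega), hL _ (by omega), if_pos (by omega), if_pos (by omega)]
  · intro j hj1 hj2
    rw [hL _ (by omega), hL _ (by omega), if_neg (by omega), if_neg (by omega)]

/-- The immaterial letter at time 0 is changed to b. Together with time n this gives the palindrome
b (a^κ b^ℓ)^m a^κ b, whose letters have period κ + ℓ. -/
lemma pencilWord_plus {κ ℓ m : ℕ} (hκ : 2 ≤ κ) (hℓ : 2 < ℓ) (hm : 1 ≤ m) :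
    PencilWord (wa (κ + 1) ++ wpow (wb ℓ ++ wa κ) m) (blockLetter κ (κ + ℓ) (κ + ℓ - 1))
      κ ℓ (κ + ℓ) (κ + 1) m := by
  have hL : ∀ j, j < κ + ℓ → blockLetter κ (κ + ℓ) (κ + ℓ - 1) j =
      if 1 ≤ j ∧ j ≤ κ then Letter.a else Letter.b := fun j hj => blockLetter_pred (by omega) hj
  have hper := blockLetter_add_mul κ (κ + ℓ) (κ + ℓ - 1)
  have hw : wa (κ + 1) ++ wpow (wb ℓ ++ wa κ) m =
      Letter.a :: (wpow (wa κ ++ wb ℓ) m ++ wa κ) := by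
    rw [wa_succ, List.cons_append, wpow_append_comm]
  obtain ⟨k, rfl⟩ := Nat.exists_eq_add_of_le' (show 1 ≤ κ by omega)
  obtain ⟨l, rfl⟩ := Nat.exists_eq_add_of_le' (show 1 ≤ ℓ by omega)
  rw [hw]
  refine ⟨hκ, hℓ, ?_, rfl, ?_, ?_, ⟨?_, ?_⟩,
    palindromicLetters_of_reverse hm (by omega) (by omega) hper ?_ ?_,
    by omega, le_rfl, by omega⟩
  · rw [← rank_periodic k l k m]
    obtain ⟨n, rfl⟩ := Nat.exists_eq_add_of_le' hm
    rw [wpow_succ, wa_succ]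
    simp only [List.cons_append, rank_cons_cons]
    simp
  · rw [List.length_cons, length_periodic]
    ring
  · intro t ht h1
    rw [getElem_cons_periodic le_rfl (by omega) m t ht h1]
  · intro t h1 h2
    rw [hL t (by omega), if_pos (by omega)]
  · intro t h1 h2
    rcases h2.eq_or_lt with rfl | h2
    · have := hper 0 1
      rw [one_mul, zero_add] at this
      rw [this, hL 0 (by omega), if_neg (by omega)]
    · rw [hL t (by omega), if_neg (by omega)]
  · intro j hj
    rw [hL _ (by omega), hL _ (by omega)]
    by_cases h : 1 ≤ j ∧ j ≤ k + 1
    · rw [if_pos h, if_pos (by omega)]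
    · rw [if_neg h, if_neg (by omega)]
  · intro j hj1 hj2
    rw [hL _ (by omega), hL _ (by omega), if_neg (by omega), if_neg (by omega)]

/-- Transfer over a block of letters `a`. -/
lemma cont_block_a {L : ℕ → Letter} (c : ℝ × ℝ) (s : ℕ) {j : ℕ}
    (h : ∀ i, 1 ≤ i → i ≤ j → L (s + i) = Letter.a) :
    cont (along c L) (s + j + 1) =
      cont (along c L) (s + 1) * cheb c.1 (j + 1) - cont (along c L) s * cheb c.1 j :=
  (isSol_cont _).block s fun i h1 h2 => by simp only [along, h i h1 h2, param]

lemma cheb_sub_cheb {β : ℝ} (h : Real.sin β ≠ 0) (n : ℕ) :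
    cheb (2 * Real.cos β) n - cheb (2 * Real.cos β) (n + 2) =
      -(2 * Real.cos ((n + 1 : ℕ) * β)) := by
  rw [cheb_eq_div h, cheb_eq_div h, ← sub_div, div_eq_iff h]
  have e1 : ((n + 2 : ℕ) : ℝ) * β = ((n + 1 : ℕ) : ℝ) * β + β := by push_cast; ring
  have e2 : (n : ℝ) * β = ((n + 1 : ℕ) : ℝ) * β - β := by push_cast; ring
  rw [e1, e2, Real.sin_add, Real.sin_sub]
  ring

lemma cheb_pos_of_angle {μ : ℝ} (h0 : 0 < μ) {j : ℕ} (hj : 1 ≤ j) (h : j * μ < Real.pi) :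
    0 < cheb (2 * Real.cos μ) j := by
  have h1 : (1 : ℝ) ≤ j := by exact_mod_cast hj
  exact cheb_pos hj ((zeta_lt_iff hj h0.le (by nlinarith)).mpr h)

/-! ### The pencils with period κ + ℓ + 1 -/

section Minus

variable {w : Word} {L : ℕ → Letter} {κ ℓ m : ℕ}

lemma PencilWord.minus_block (h : PencilWord w L κ ℓ (κ + ℓ + 1) κ m) (c : ℝ × ℝ) {j : ℕ}
    (hj : j ≤ κ + 1) :
    cont (along c L) (κ + ℓ + j + 1) =
      cont (along c L) (κ + ℓ + 1) * cheb c.1 (j + 1) - cont (along c L) (κ + ℓ) * cheb c.1 j := by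
  refine cont_block_a c (κ + ℓ) fun i h1 h2 => ?_
  obtain ⟨k, rfl⟩ := Nat.exists_eq_add_of_le' h1
  rw [show κ + ℓ + (k + 1) = k + (κ + ℓ + 1) by ring, h.pal.periodic]
  rcases Nat.eq_zero_or_pos k with rfl | hk
  · have h3 := h.pal.reverse 0 (by omega)
    have h4 : ∀ i, L (κ + i * (κ + ℓ + 1)) = L κ := by
      intro i
      induction i with
      | zero => simp
      | succ i ih =>
        rw [show κ + (i + 1) * (κ + ℓ + 1) = κ + i * (κ + ℓ + 1) + (κ + ℓ + 1) by ring,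
          h.pal.periodic, ih]
    rw [← h3, Nat.sub_zero, h4]
    exact h.blocks.block_a κ (by have := h.two_le; omega) le_rfl
  · exact h.blocks.block_a k hk (by omega)

/-- The path runs upwards from b₀ to b₁, and Q_q = S_κ(x) > 0 does not depend on b. At b₀ the value
Q_{κ+ℓ} vanishes, so Q_{q+p} = Q_p S_{κ+1}(x) ≤ 0. At b₁ one has Q_p = 0 and Q_{p+1} = -Q_{κ+ℓ} ≥ 0.
-/
lemma PencilWord.minus_interior (h : PencilWord w L κ ℓ (κ + ℓ + 1) κ m) {x : ℝ}
    (h1 : zeta κ < x) (h2 : x < zeta (κ + 1)) : ∃ b, Legal w (x, b) := by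
  have hℓ := h.three_le
  obtain ⟨hr, hq⟩ := neg_cheb_window h.two_le h1 h2
  obtain ⟨b₀, b₁, hb1, hb2, hb3, hb4, hb5⟩ := exists_window h.two_le hℓ h1 h2
  have e1 : ∀ b, cont (along (x, b) L) (κ + ℓ) =
      cheb x (κ + 1) * cheb b ℓ - cheb x κ * cheb b (ℓ - 1) := by
    intro b
    have := h.blocks.cont_right (x, b) (j := ℓ - 1) (by omega)
    rwa [show κ + (ℓ - 1) + 1 = κ + ℓ by omega, show ℓ - 1 + 1 = ℓ by omega] at this
  have e2 : ∀ b, cont (along (x, b) L) (κ + ℓ + 1) =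
      cheb x (κ + 1) * cheb b (ℓ + 1) - cheb x κ * cheb b ℓ :=
    fun b => h.blocks.cont_right (x, b) le_rfl
  have eκ : ∀ b, cont (along (x, b) L) κ = cheb x κ :=
    fun b => h.blocks.cont_left (x, b) (by omega)
  obtain ⟨b, hx1, hx2, hx3, hx4⟩ := h.pal.exists_zero (c := fun b => (x, b)) (by fun_prop)
    (C := cheb x κ) hb2 hr.ne' eκ
    (by
      rw [show κ + (κ + ℓ + 1) = κ + ℓ + κ + 1 by ring, h.minus_block _ (by omega), e1, hb3]
      have := (hb5 b₀ le_rfl hb2).2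
      rw [← e2] at this
      have := mul_nonneg this (neg_nonneg.mpr hq.le)
      nlinarith)
    (by rw [e2, hb4])
    (by
      have := h.minus_block (x, b₁) (j := 1) (by omega)
      rw [this, e2, hb4, e1]
      have := (hb5 b₁ hb2 le_rfl).1
      simp
      linarith)
  refine ⟨b, h.legal_of_product h1.le h2.le (by simp only; linarith) ?_ hx4 hx3 ?_ ?_⟩
  · rw [e1]
    exact (hb5 b hx1 hx2).1
  · rw [eκ]
    exact hr.ne'
  · rw [eκ, e2]
    exact mul_nonneg (hb5 b hx1 hx2).2 hr.le

/-- Here Q_p = 0 and Q_{p+1} = 1: the orbit of the boundary point closes up after one period, which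
makes the point legal for every m. -/
lemma PencilWord.minus_basis (h : PencilWord w L κ ℓ (κ + ℓ + 1) κ m) :
    Legal w (zeta κ, zeta (ℓ + 1)) := by
  have hκ := h.two_le
  have hℓ := h.three_le
  have e1 := h.blocks.cont_right (zeta κ, zeta (ℓ + 1)) (j := ℓ - 1) (by omega)
  have e2 := h.blocks.cont_right (zeta κ, zeta (ℓ + 1)) (j := ℓ) le_rfl
  have e3 := h.minus_block (zeta κ, zeta (ℓ + 1)) (j := 1) (by omega)
  have s := cheb_zeta_pred (show 2 ≤ ℓ + 1 by omega)
  rw [Nat.add_sub_cancel] at s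
  rw [show κ + (ℓ - 1) + 1 = κ + ℓ by omega, show ℓ - 1 + 1 = ℓ by omega] at e1
  simp only [cheb_zeta_self hκ, cheb_zeta_succ hκ, s] at e1
  simp only [cheb_zeta_self hκ, cheb_zeta_succ hκ, cheb_zeta_self (show 2 ≤ ℓ + 1 by omega)] at e2
  rw [e1, e2] at e3
  refine h.legal_basis le_rfl (zeta_le_zeta (by omega) (by omega))
    (zeta_le_zeta (by omega) (by omega)) ?_ ?_ ?_ ?_ ?_
  · rw [e1]
    norm_num
  · rw [e2]
    norm_num
  · exact e3.trans (by simp)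
  · rw [h.blocks.cont_left _ (by omega)]
    exact cheb_zeta_self hκ
  · rw [h.blocks.cont_left _ (by omega)]
    exact (cheb_zeta_pred hκ).symm ▸ zero_le_one

/-- The end-point of the arc for which `a` is a half-turn by `κ + 1` letters. -/
lemma PencilWord.minus_end (h : PencilWord w L κ ℓ (κ + ℓ + 1) κ m) {μ : ℝ}
    (hμ : (m * ℓ - 1 : ℝ) * μ = Real.pi) :
    zeta (ℓ - 1) ≤ 2 * Real.cos (m * μ) ∧ Legal w (zeta (κ + 1), 2 * Real.cos (m * μ)) := by
  have hκ := h.two_le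
  have hℓ := h.three_le
  have hm := h.pal.one_le_m
  have hℓ' : (3 : ℝ) ≤ ℓ := by exact_mod_cast hℓ
  have hm' : (1 : ℝ) ≤ m := by exact_mod_cast hm
  have hpi := Real.pi_pos
  have hmℓ : (m : ℝ) + 1 ≤ m * ℓ - 1 := by nlinarith
  have hμ0 : 0 < μ := by
    by_contra! hneg
    nlinarith
  have hmμ : m * μ < Real.pi := by nlinarith
  have hmμ0 : 0 < m * μ := by positivity
  obtain ⟨l, rfl⟩ := Nat.exists_eq_add_of_le' (show 1 ≤ ℓ by omega)
  rw [Nat.add_sub_cancel]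
  push_cast at hμ
  -- The angle β = mμ of b satisfies ℓβ = π + μ. Hence the trace is S_{ℓ-1}(b) - S_{ℓ+1}(b) = -2 cos
  -- (ℓβ) = 2 cos μ.
  have ha2 : ((l + 1 : ℕ) : ℝ) * (m * μ) = Real.pi + μ := by
    push_cast
    linear_combination hμ
  have ha1 : (l : ℝ) * (m * μ) = Real.pi + μ - m * μ := by
    push_cast at ha2
    linarith
  have hs := Real.sin_pos_of_pos_of_lt_pi hmμ0 hmμ
  have hμm : μ ≤ m * μ := by nlinarith
  have hb : zeta l ≤ 2 * Real.cos (m * μ) := by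
    rw [← not_lt, lt_zeta_iff (by omega) hmμ0.le hmμ.le, ha1]
    linarith
  have hnn : 0 ≤ cheb (2 * Real.cos (m * μ)) l := cheb_nonneg (by omega) hb le_rfl
  refine ⟨hb, ?_⟩
  set b := 2 * Real.cos (m * μ) with hbdef
  have p1 := cheb_zeta_self (show 2 ≤ κ + 1 by omega)
  have p2 := cheb_zeta_pred (show 2 ≤ κ + 1 by omega)
  have p3 := cheb_zeta_reflect (show 2 ≤ κ + 1 by omega) (i := 2) (by omega)
  rw [Nat.add_sub_cancel] at p2
  rw [show κ + 1 - 2 = κ - 1 by omega, cheb_two] at p3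
  have e1 : cont (along (zeta (κ + 1), b) L) (κ + (l + 1)) = -cheb b l := by
    have := h.blocks.cont_right (zeta (κ + 1), b) (j := l) (by omega)
    rw [show κ + (l + 1) = κ + l + 1 by ring, this, p1, p2]
    ring
  have e2 : cont (along (zeta (κ + 1), b) L) (κ + (l + 1) + 1) = -cheb b (l + 1) := by
    rw [h.blocks.cont_right (zeta (κ + 1), b) le_rfl, p1, p2]
    ring
  have e3 : cont (along (zeta (κ + 1), b) L) (κ + (κ + (l + 1) + 1)) = cheb b l := by
    rw [show κ + (κ + (l + 1) + 1) = κ + (l + 1) + κ + 1 by ring, h.minus_block _ (by omega),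
      e1, p1, p2]
    ring
  have eκ : cont (along (zeta (κ + 1), b) L) κ = 1 := by
    rw [h.blocks.cont_left _ (by omega), p2]
  have hτ : tau (along (zeta (κ + 1), b) L) (κ + (l + 1) + 1) = 2 * Real.cos μ := by
    have e4 := h.minus_block (zeta (κ + 1), b) (j := 1) (by omega)
    obtain ⟨k, rfl⟩ := Nat.exists_eq_add_of_le' (show 1 ≤ κ by omega)
    have e5 := h.blocks.shift.cont_right (zeta (k + 1 + 1), b) (j := l + 1) le_rfl
    rw [Nat.add_sub_cancel] at p3
    rw [p2, p3] at e5
    rw [tau, e4, e1, e2, Nat.add_sub_cancel, show k + 1 + (l + 1) = k + (l + 1) + 1 by ring]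
    change _ - cont (along (zeta (k + 1 + 1), b) fun t => L (t + 1)) _ = _
    rw [e5]
    have := cheb_sub_cheb hs.ne' l
    rw [ha2, ← hbdef, add_comm Real.pi, Real.cos_add_pi] at this
    have c2 : cheb (zeta (k + 1 + 1)) (1 + 1) = zeta (k + 1 + 1) := cheb_two _
    rw [show l + 1 + 1 = l + 2 by ring, c2, cheb_one]
    linear_combination this
  have hpos : ∀ j, 1 ≤ j → j ≤ m →
      0 < cheb (tau (along (zeta (κ + 1), b) L) (κ + (l + 1) + 1)) j := by
    intro j hj1 hj2
    rw [hτ]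
    have : (j : ℝ) ≤ m := by exact_mod_cast hj2
    exact cheb_pos_of_angle hμ0 hj1 (by nlinarith)
  refine h.legal_of_product (zeta_le_zeta (by omega) (by omega)) le_rfl hb ?_ hpos ?_ ?_ ?_
  · rw [e1]
    linarith
  -- With m = k + 1 the continuant is S_{ℓ-1}(b) S_m(τ) - S_k(τ). It vanishes because the factors
  -- sin (mμ) cancel and sin ((ℓ-1)mμ) = sin (kμ).
  · obtain ⟨k, rfl⟩ := Nat.exists_eq_add_of_le' hm
    rw [cont_add_mul_period (by omega) (along_periodic h.pal.periodic _), e3, eκ, hτ, hbdef,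
      cheb_eq_div hs.ne', ha1]
    have hsμ := Real.sin_pos_of_pos_of_lt_pi hμ0 (by linarith)
    rw [cheb_eq_div hsμ.ne', cheb_eq_div hsμ.ne']
    have : Real.pi + μ - ((k + 1 : ℕ) : ℝ) * μ = Real.pi - k * μ := by push_cast; ring
    rw [this, Real.sin_pi_sub]
    generalize Real.sin (((k + 1 : ℕ) : ℝ) * μ) = s at hs ⊢
    field_simp
    ring
  · rw [eκ]
    exact one_ne_zero
  · rw [eκ, e2, mul_one, hbdef, cheb_eq_div hs.ne', ha2, add_comm, Real.sin_add_pi]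
    have hsμ := Real.sin_pos_of_pos_of_lt_pi hμ0 (by linarith)
    rw [neg_div, neg_neg]
    positivity

end Minus

/-! ### The pencils with period κ + ℓ -/

section Plus

variable {w : Word} {L : ℕ → Letter} {κ ℓ m : ℕ}

lemma PencilWord.plus_block (h : PencilWord w L κ ℓ (κ + ℓ) (κ + 1) m) (c : ℝ × ℝ) :
    cont (along c L) (κ + 1 + (κ + ℓ)) =
      cont (along c L) (κ + ℓ + 1) * cheb c.1 (κ + 1) - cont (along c L) (κ + ℓ) * cheb c.1 κ := by
  rw [show κ + 1 + (κ + ℓ) = κ + ℓ + κ + 1 by ring]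
  refine cont_block_a c (κ + ℓ) fun i h1 h2 => ?_
  rw [add_comm, h.pal.periodic]
  exact h.blocks.block_a i h1 h2

/-- Now p = κ + ℓ, so Q_p vanishes at b₀ instead of b₁ and the path is traversed downwards. The
constant Q_q = S_{κ+1}(x) is negative. -/
lemma PencilWord.plus_interior (h : PencilWord w L κ ℓ (κ + ℓ) (κ + 1) m) {x : ℝ}
    (h1 : zeta κ < x) (h2 : x < zeta (κ + 1)) : ∃ b, Legal w (x, b) := by
  have hℓ := h.three_le
  obtain ⟨hr, hq⟩ := neg_cheb_window h.two_le h1 h2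
  obtain ⟨b₀, b₁, hb1, hb2, hb3, hb4, hb5⟩ := exists_window h.two_le hℓ h1 h2
  have e1 : ∀ b, cont (along (x, b) L) (κ + ℓ) =
      cheb x (κ + 1) * cheb b ℓ - cheb x κ * cheb b (ℓ - 1) := by
    intro b
    have := h.blocks.cont_right (x, b) (j := ℓ - 1) (by omega)
    rwa [show κ + (ℓ - 1) + 1 = κ + ℓ by omega, show ℓ - 1 + 1 = ℓ by omega] at this
  have e2 : ∀ b, cont (along (x, b) L) (κ + ℓ + 1) =
      cheb x (κ + 1) * cheb b (ℓ + 1) - cheb x κ * cheb b ℓ :=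
    fun b => h.blocks.cont_right (x, b) le_rfl
  have eκ : ∀ b, cont (along (x, b) L) (κ + 1) = cheb x (κ + 1) :=
    fun b => h.blocks.cont_left (x, b) le_rfl
  obtain ⟨b, hx1, hx2, hx3, hx4⟩ := h.pal.exists_zero (c := fun b => (x, -b)) (by fun_prop)
    (C := cheb x (κ + 1)) (neg_le_neg hb2) hq.ne (fun b => eκ (-b))
    (by
      rw [neg_neg, h.plus_block, e2, hb4]
      have := (hb5 b₁ hb2 le_rfl).1
      rw [← e1] at this
      have := mul_nonneg (neg_nonneg.mpr this) hr.le
      nlinarith)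
    (by rw [neg_neg, e1, hb3])
    (by rw [neg_neg, e2]; exact (hb5 b₀ le_rfl hb2).2)
  have hw := hb5 (-b) (by linarith) (by linarith)
  refine ⟨-b, h.legal_of_product h1.le h2.le (by simp only; linarith) ?_ hx4 hx3 ?_ ?_⟩
  · rw [e1]
    exact hw.1
  · rw [eκ]
    exact hq.ne
  · rw [eκ, e1]
    exact mul_nonneg_of_nonpos_of_nonpos hw.1 hq.le

lemma PencilWord.plus_basis (h : PencilWord w L κ ℓ (κ + ℓ) (κ + 1) m) :
    Legal w (zeta (κ + 1), zeta (ℓ - 1)) := by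
  have hκ := h.two_le
  have hℓ := h.three_le
  obtain ⟨l, rfl⟩ := Nat.exists_eq_add_of_le' (show 1 ≤ ℓ by omega)
  rw [Nat.add_sub_cancel]
  have e1 := h.blocks.cont_right (zeta (κ + 1), zeta l) (j := l) (by omega)
  have e2 := h.blocks.cont_right (zeta (κ + 1), zeta l) (j := l + 1) le_rfl
  have p1 := cheb_zeta_self (show 2 ≤ κ + 1 by omega)
  have p2 := cheb_zeta_pred (show 2 ≤ κ + 1 by omega)
  rw [Nat.add_sub_cancel] at p2
  rw [p1, cheb_zeta_self (show 2 ≤ l by omega)] at e1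
  rw [p1, p2, cheb_zeta_succ (show 2 ≤ l by omega)] at e2
  refine h.legal_basis (zeta_le_zeta (by omega) (by omega)) le_rfl le_rfl ?_ ?_ ?_ ?_ ?_
  · rw [← add_assoc, e1]
    simp
  · rw [← add_assoc, e1]
    simp
  · rw [e2]
    simp
  · rw [h.blocks.cont_left _ le_rfl, p1]
  · rw [h.blocks.cont_left _ (by omega), Nat.add_sub_cancel, p2]
    exact zero_le_one

/-- The end-point of the arc for which `a` is a half-turn by `κ` letters. -/
lemma PencilWord.plus_end (h : PencilWord w L κ ℓ (κ + ℓ) (κ + 1) m) {μ : ℝ}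
    (hμ : (m * ℓ + 1 : ℝ) * μ = Real.pi) : Legal w (zeta κ, 2 * Real.cos (m * μ)) := by
  have hκ := h.two_le
  have hℓ := h.three_le
  have hm := h.pal.one_le_m
  have hℓ' : (3 : ℝ) ≤ ℓ := by exact_mod_cast hℓ
  have hm' : (1 : ℝ) ≤ m := by exact_mod_cast hm
  have hpi := Real.pi_pos
  have hmℓ : (m : ℝ) + 1 ≤ m * ℓ + 1 := by nlinarith
  have hμ0 : 0 < μ := by
    by_contra! hneg
    nlinarith
  have hmμ : m * μ < Real.pi := by nlinarith
  have hmμ0 : 0 < m * μ := by positivity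
  obtain ⟨l, rfl⟩ := Nat.exists_eq_add_of_le' (show 1 ≤ ℓ by omega)
  push_cast at hμ
  have ha1 : ((l + 1 : ℕ) : ℝ) * (m * μ) = Real.pi - μ := by
    push_cast
    linear_combination hμ
  have ha2 : ((l + 1 + 1 : ℕ) : ℝ) * (m * μ) = Real.pi - (μ - m * μ) := by
    push_cast at ha1 ⊢
    linarith
  have hs := Real.sin_pos_of_pos_of_lt_pi hmμ0 hmμ
  have hb : zeta l ≤ 2 * Real.cos (m * μ) := by
    rw [← not_lt, lt_zeta_iff (by omega) hmμ0.le hmμ.le]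
    push_cast at ha1
    linarith
  have hb' : zeta (l + 1) ≤ 2 * Real.cos (m * μ) := by
    rw [← not_lt, lt_zeta_iff (by omega) hmμ0.le hmμ.le, ha1]
    linarith
  have hnn : 0 ≤ cheb (2 * Real.cos (m * μ)) (l + 1) := cheb_nonneg (by omega) hb' le_rfl
  set b := 2 * Real.cos (m * μ) with hbdef
  have p1 := cheb_zeta_self hκ
  have p2 := cheb_zeta_pred hκ
  have p3 := cheb_zeta_succ hκ
  have e1 : cont (along (zeta κ, b) L) (κ + (l + 1)) = -cheb b (l + 1) := by
    have := h.blocks.cont_right (zeta κ, b) (j := l) (by omega)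
    rw [show κ + (l + 1) = κ + l + 1 by ring, this, p1, p3]
    ring
  have e2 : cont (along (zeta κ, b) L) (κ + (l + 1) + 1) = -cheb b (l + 1 + 1) := by
    rw [h.blocks.cont_right (zeta κ, b) le_rfl, p1, p3]
    ring
  have eκ : cont (along (zeta κ, b) L) (κ + 1) = -1 := by
    rw [h.blocks.cont_left _ le_rfl, p3]
  have hτ : tau (along (zeta κ, b) L) (κ + (l + 1)) = 2 * Real.cos μ := by
    obtain ⟨k, rfl⟩ := Nat.exists_eq_add_of_le' (show 1 ≤ κ by omega)
    have e5 := h.blocks.shift.cont_right (zeta (k + 1), b) (j := l) (by omega)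
    rw [Nat.add_sub_cancel] at p2
    rw [p1, p2] at e5
    rw [tau, e2, show k + 1 + (l + 1) - 1 = k + l + 1 by omega]
    change _ - cont (along (zeta (k + 1), b) fun t => L (t + 1)) _ = _
    rw [e5]
    have := cheb_sub_cheb hs.ne' l
    rw [ha1, ← hbdef, Real.cos_pi_sub] at this
    rw [show l + 1 + 1 = l + 2 by ring]
    linear_combination this
  have hpos : ∀ j, 1 ≤ j → j ≤ m →
      0 < cheb (tau (along (zeta κ, b) L) (κ + (l + 1))) j := by
    intro j hj1 hj2
    rw [hτ]
    have : (j : ℝ) ≤ m := by exact_mod_cast hj2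
    exact cheb_pos_of_angle hμ0 hj1 (by nlinarith)
  refine h.legal_of_product le_rfl (zeta_le_zeta (by omega) (by omega)) hb ?_ hpos ?_ ?_ ?_
  · rw [e1]
    linarith
  -- With m = k + 1 the continuant is S_{ℓ+1}(b) S_m(τ) + S_k(τ), and sin ((ℓ+1)mμ) = -sin (kμ)
  -- because ℓmμ = π - μ.
  · obtain ⟨k, rfl⟩ := Nat.exists_eq_add_of_le' hm
    rw [cont_add_mul_period (by omega) (along_periodic h.pal.periodic _), h.plus_block, e1, e2,
      eκ, p1, p3, hτ, hbdef, cheb_eq_div hs.ne' (l + 1 + 1), ha2]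
    have hsμ := Real.sin_pos_of_pos_of_lt_pi hμ0 (by nlinarith)
    rw [cheb_eq_div hsμ.ne', cheb_eq_div hsμ.ne', Real.sin_pi_sub,
      show μ - ((k + 1 : ℕ) : ℝ) * μ = -(k * μ) by push_cast; ring, Real.sin_neg]
    generalize Real.sin (((k + 1 : ℕ) : ℝ) * μ) = s at hs ⊢
    field_simp
    ring
  · rw [eκ]
    norm_num
  · rw [eκ, e1]
    linarith

end Plus

/-! ### End-points, rotation numbers and conclusion -/

lemma hasRotationNumber_zeta_angle {k : ℕ} (hk : 2 ≤ k) {t θ : ℝ} (h0 : 0 < t) (h1 : t < 1)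
    (hθ : θ = t / (k * t + 1)) : HasRotationNumber (zeta k, 2 * Real.cos (Real.pi * t)) θ := by
  have hp := Real.pi_pos
  have := hasRotationNumber_zeta hk (β := Real.pi * t) (by positivity) (by nlinarith)
  convert this using 1
  rw [hθ]
  have : (0 : ℝ) < k * t + 1 := by positivity
  field_simp

lemma hasRotationNumber_doublePoint {k l : ℕ} (hk : 2 ≤ k) (hl : 2 ≤ l) :
    HasRotationNumber (doublePoint k l) (1 / ((k : ℝ) + l)) := by
  have hl' : (2 : ℝ) ≤ l := by exact_mod_cast hl
  have := hasRotationNumber_zeta_angle hk (t := 1 / l) (θ := 1 / ((k : ℝ) + l)) (by positivity)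
    (by rw [div_lt_one (by linarith)]; linarith) (by field_simp)
  rw [mul_one_div] at this
  exact this

lemma isCriticalCurve_minus {κ ℓ m : ℕ} (hκ : 2 ≤ κ) (hℓ : 2 < ℓ) (hm : 1 ≤ m) :
    IsCriticalCurveWithEndpoints (wpow (wa (κ + 1) ++ wb ℓ) m ++ wa κ) m
      (doublePoint κ (ℓ + 1)) (zeta (κ + 1), zetaMinus ℓ m)
      (1 / ((κ : ℝ) + ℓ + 1)) (thetaMinus (κ + ℓ + 1) m) := by
  have h := pencilWord_minus hκ hℓ hm
  have hℓ' : (3 : ℝ) ≤ ℓ := by exact_mod_cast hℓ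
  have hm' : (1 : ℝ) ≤ m := by exact_mod_cast hm
  have hd : (m : ℝ) < m * ℓ - 1 := by nlinarith
  have hd0 : (0 : ℝ) < m * ℓ - 1 := by linarith
  have hz : zetaMinus ℓ m = 2 * Real.cos (m * (Real.pi / (m * ℓ - 1))) := by
    unfold zetaMinus thetaMinus
    congr 2
    ring
  obtain ⟨hb, hend⟩ := h.minus_end (μ := Real.pi / (m * ℓ - 1)) (by field_simp)
  rw [← hz] at hb hend
  obtain ⟨h1, h2⟩ := h.isArc h.minus_basis hend ((zeta_nonneg (by omega)).trans hb)
    fun x h1 h2 => h.minus_interior h1 h2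
  refine ⟨h.rank_eq, h1, h2, ?_, ?_⟩
  · have := hasRotationNumber_doublePoint hκ (show 2 ≤ ℓ + 1 by omega)
    push_cast at this
    rwa [← add_assoc] at this
  · refine hasRotationNumber_zeta_angle (by omega) ?_ ?_ ?_
    · exact div_pos (by linarith) hd0
    · rw [thetaMinus, div_lt_one hd0]
      exact hd
    · unfold thetaMinus
      push_cast
      have : (0 : ℝ) < m * (κ + ℓ + 1) - 1 := by
        have : (0 : ℝ) ≤ κ := by positivity
        nlinarith
      have h3 : (0 : ℝ) < (κ + 1) * (m / (m * ℓ - 1)) + 1 := by positivity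
      rw [div_eq_div_iff this.ne' h3.ne']
      field_simp
      ring

lemma isCriticalCurve_plus {κ ℓ m : ℕ} (hκ : 2 ≤ κ) (hℓ : 2 < ℓ) (hm : 1 ≤ m) :
    IsCriticalCurveWithEndpoints (wa (κ + 1) ++ wpow (wb ℓ ++ wa κ) m) m
      (doublePoint (κ + 1) (ℓ - 1)) (zeta κ, zetaPlus ℓ m)
      (1 / ((κ : ℝ) + ℓ)) (thetaPlus (κ + ℓ) m) := by
  have h := pencilWord_plus hκ hℓ hm
  have hℓ' : (3 : ℝ) ≤ ℓ := by exact_mod_cast hℓ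
  have hm' : (1 : ℝ) ≤ m := by exact_mod_cast hm
  have hd : (m : ℝ) < m * ℓ + 1 := by nlinarith
  have hd0 : (0 : ℝ) < m * ℓ + 1 := by linarith
  have hz : zetaPlus ℓ m = 2 * Real.cos (m * (Real.pi / (m * ℓ + 1))) := by
    unfold zetaPlus thetaPlus
    congr 2
    ring
  have hend := h.plus_end (μ := Real.pi / (m * ℓ + 1)) (by field_simp)
  rw [← hz] at hend
  obtain ⟨h1, h2⟩ := h.isArc hend h.plus_basis (zeta_nonneg (by omega))
    fun x h1 h2 => h.plus_interior h1 h2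
  refine ⟨h.rank_eq, h1, h2.symm, ?_, ?_⟩
  · have := hasRotationNumber_doublePoint (show 2 ≤ κ + 1 by omega) (show 2 ≤ ℓ - 1 by omega)
    rw [Nat.cast_sub (by omega)] at this
    push_cast at this
    rwa [add_add_sub_cancel] at this
  · refine hasRotationNumber_zeta_angle hκ ?_ ?_ ?_
    · exact div_pos (by linarith) hd0
    · rw [thetaPlus, div_lt_one hd0]
      exact hd
    · unfold thetaPlus
      push_cast
      have : (0 : ℝ) < m * (κ + ℓ) + 1 := by positivity
      have h3 : (0 : ℝ) < κ * (m / (m * ℓ + 1)) + 1 := by positivity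
      rw [div_eq_div_iff this.ne' h3.ne']
      field_simp
      ring

end CriticalCurves

end

theorem mainTheorem1 :
    (∀ κ ℓ : ℕ, 2 ≤ κ → 2 ≤ ℓ →
      rank (wa (κ + 1) ++ wb ℓ) = 2 ∧
      rank (wb (ℓ + 1) ++ wa κ) = 2 ∧
      curvePoly (wa (κ + 1) ++ wb ℓ) = curvePoly (wb (ℓ + 1) ++ wa κ) ∧
      curve (wa (κ + 1) ++ wb ℓ) = curve (wb (ℓ + 1) ++ wa κ) ∧
      legalArc (wa (κ + 1) ++ wb ℓ) = legalArc (wb (ℓ + 1) ++ wa κ) ∧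
      legalArc (wa (κ + 1) ++ wb ℓ) ⊆ firstQuadrant ∧
      IsArcWithEndpoints (legalArc (wa (κ + 1) ++ wb ℓ))
        (doublePoint κ (ℓ + 1)) (doublePoint (κ + 1) ℓ)) ∧
    (∀ κ ℓ m : ℕ, 2 ≤ κ → 2 < ℓ → 1 ≤ m →
      IsCriticalCurveWithEndpoints (wpow (wa (κ + 1) ++ wb ℓ) m ++ wa κ) m
        (doublePoint κ (ℓ + 1)) (zeta (κ + 1), zetaMinus ℓ m)
        (1 / ((κ : ℝ) + ℓ + 1)) (thetaMinus (κ + ℓ + 1) m)) ∧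
    (∀ κ ℓ m : ℕ, 2 ≤ κ → 2 < ℓ → 1 ≤ m →
      IsCriticalCurveWithEndpoints (wa (κ + 1) ++ wpow (wb ℓ ++ wa κ) m) m
        (doublePoint (κ + 1) (ℓ - 1)) (zeta κ, zetaPlus ℓ m)
        (1 / ((κ : ℝ) + ℓ)) (thetaPlus (κ + ℓ) m)) ∧
    (∀ κ ℓ m : ℕ, 2 < κ → 2 ≤ ℓ → 1 ≤ m →
      IsCriticalCurveWithEndpoints (wpow (wb (ℓ + 1) ++ wa κ) m ++ wb ℓ) m
        (doublePoint (κ + 1) ℓ) (zetaMinus κ m, zeta (ℓ + 1))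
        (1 / ((κ : ℝ) + ℓ + 1)) (thetaMinus (κ + ℓ + 1) m)) ∧
    (∀ κ ℓ m : ℕ, 2 < κ → 2 ≤ ℓ → 1 ≤ m →
      IsCriticalCurveWithEndpoints (wb (ℓ + 1) ++ wpow (wa κ ++ wb ℓ) m) m
        (doublePoint (κ - 1) (ℓ + 1)) (zetaPlus κ m, zeta ℓ)
        (1 / ((κ : ℝ) + ℓ)) (thetaPlus (κ + ℓ) m)) := by
  refine ⟨fun κ ℓ hκ hℓ => ?_, fun κ ℓ m hκ hℓ hm => isCriticalCurve_minus hκ hℓ hm,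
    fun κ ℓ m hκ hℓ hm => isCriticalCurve_plus hκ hℓ hm, fun κ ℓ m hκ hℓ hm => ?_,
    fun κ ℓ m hκ hℓ hm => ?_⟩
  · have hpoly : curvePoly (wa (κ + 1) ++ wb ℓ) = curvePoly (wb (ℓ + 1) ++ wa κ) :=
      eq_of_aeval_eq fun c => by
        rw [aeval_curvePoly_wa_wb (by omega), aeval_curvePoly_wb_wa (by omega)]
    refine ⟨?_, ?_, hpoly, by simp only [curve, hpoly], legalArc_wb_wa hκ hℓ, ?_,
      isArc_wa_wb hκ hℓ⟩
    · obtain ⟨j, rfl⟩ := Nat.exists_eq_add_of_le' (show 1 ≤ ℓ by omega)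
      exact rank_wa_wb κ j
    · obtain ⟨j, rfl⟩ := Nat.exists_eq_add_of_le' (show 1 ≤ κ by omega)
      rw [← map_flip_wa_wb, rank_map_flip, rank_wa_wb]
    · intro c hc
      have h := (legal_wa_wb_iff hκ hℓ c).mp hc.2
      exact ⟨(zeta_nonneg hκ).trans h.1.1, (zeta_nonneg hℓ).trans h.2.1.1⟩
  -- The remaining two families are the mirror images of the first two, with the roles of κ and ℓ
  -- exchanged.
  · have h := (isCriticalCurve_minus hℓ hκ hm).map_flip (by
      rw [length_periodic]
      omega)
    simp only [List.map_append, map_flip_wpow, map_flip_wa, map_flip_wb] at h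
    rwa [add_comm (ℓ : ℝ) (κ : ℝ), add_comm ℓ κ] at h
  · have h := (isCriticalCurve_plus hℓ hκ hm).map_flip (by
      rw [List.length_append]
      simp [wa]
      omega)
    simp only [List.map_append, map_flip_wpow, map_flip_wa, map_flip_wb] at h
    rwa [add_comm (ℓ : ℝ) (κ : ℝ), add_comm ℓ κ] at h
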